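/- **Strong form of the principle of exchange of stabilities.** Let $k_x,k_y,A,\gamma>0$, $\mathrm{Da}\ge 0$ and $\mathrm{Ra},\zeta,H\in\mathbb R$. Put $M(z)=\zeta-z$, let $\mathbf k=(0,0,1)$, and let $\Omega=[0,2\pi/k_x]\times[0,2\pi/k_y]\times[0,1]$ be the periodicity cell. All fields below are complex-valued, periodic in $x$ and $y$ with periods $2\pi/k_x$ and $2\pi/k_y$; derivatives are weak derivatives, equations hold a.e. in $\Omega$, boundary values are traces, and $W^{m,2}$ denotes the space of such periodic fields with weak derivatives up to order $m$ in $L^2(\Omega)$. Write $\Delta_1=\partial_x^2+\partial_y^2$ and $\mathcal L=\Delta-\mathrm{Da}\,\Delta\Delta$. (a) Let $\sigma\in\mathbb C$ be a temporal growth rate of the linearised penetrative convection problem, i.e. suppose that there are $\mathbf u=(u,v,w)$, $\pi$, $\theta$, $\phi$ in $W^{2,2}$ with $(\mathbf u,\theta,\phi)\neq 0$ such that $(\mathbf u,\pi,\theta,\phi)e^{\sigma t}$ solves the linearised perturbation equations, that is, $$\mathbf u=-\nabla\pi-\mathrm{Ra}\,M(z)\,\theta\,\mathbf k+\mathrm{Da}\,\Delta\mathbf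 u,\qquad \nabla\cdot\mathbf u=0,$$ $$\sigma\theta+\mathrm{Ra}\,w=\Delta\theta+H(\phi-\theta),\qquad A\sigma\phi=\Delta\phi-H\gamma(\phi-\theta),$$ with the stress-free boundary conditions $\partial_z u=\partial_z v=w=\theta=\phi=0$ on $z=0,1$. Then $\sigma\in\mathbb R$. In particular $\operatorname{Re}\sigma=0$ implies $\sigma=0$, so convection can set in only through stationary (non-oscillatory) modes. (b) The same conclusion holds for every eigenvalue $\sigma\in\mathbb C$ of the reduced problem in which the momentum and continuity equations are replaced by the third component of the double curl of the momentum equation: if there are $w\in W^{4,2}$ and $\theta,\phi\in W^{2,2}$, not all zero, with $$\mathcal L w=-\mathrm{Ra}\,M(z)\,\Delta_1\theta,\qquad \sigma\theta+\mathrm{Ra}\,w=\Delta\theta+H(\phi-\theta),\qquad \sigma\frac{A}{\gamma}\phi=\frac1\gamma\Delta\phi-H(\phi-\theta),$$ and $w=\partial_z^2w=\theta=\phi=0$ on $z=0,1$, then $\sigma\in\mathbb R$, and $\operatorname{Re}\sigma=0$ implies $\sigma=0$. -/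

import Mathlib

open MeasureTheory
open scoped ContDiff

noncomputable section

namespace Penetrative

/-- Complex-valued fields on space; a point is `p = (x, y, z) = (p 0, p 1, p 2)`. -/
abbrev Field3 := (Fin 3 → ℝ) → ℂ

/-- The periodicity cell `[0, 2π/kx] × [0, 2π/ky] × [0, 1]`. -/
def cell (kx ky : ℝ) : Set (Fin 3 → ℝ) :=
  Set.Icc 0 ![2 * Real.pi / kx, 2 * Real.pi / ky, 1]

/-- Periodicity in `x` with period `2π/kx` and in `y` with period `2π/ky`. -/
def HorizPeriodic (kx ky : ℝ) (f : Field3) : Prop :=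
  (∀ p, f (p + Pi.single 0 (2 * Real.pi / kx)) = f p) ∧
    ∀ p, f (p + Pi.single 1 (2 * Real.pi / ky)) = f p

/-- The classical partial derivative in the `i`-th coordinate, used for test functions only. -/
def pderiv (i : Fin 3) (ψ : Field3) : Field3 := fun p => fderiv ℝ ψ p (Pi.single i 1)

/-- Smooth horizontally periodic functions, with no condition at the walls `z = 0, 1`. -/
def IsPeriodicSmooth (kx ky : ℝ) (ψ : Field3) : Prop :=
  ContDiff ℝ ∞ ψ ∧ HorizPeriodic kx ky ψ

/-- Test functions on the open layer: smooth, horizontally periodic, and vanishing near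
the walls `z = 0` and `z = 1`. -/
def IsTest (kx ky : ℝ) (ψ : Field3) : Prop :=
  IsPeriodicSmooth kx ky ψ ∧ ∃ δ > 0, ∀ p, p 2 ∉ Set.Icc δ (1 - δ) → ψ p = 0

/-- Horizontally periodic fields that are square integrable on the cell. -/
def MemL2 (kx ky : ℝ) (f : Field3) : Prop :=
  HorizPeriodic kx ky f ∧ MemLp f 2 (volume.restrict (cell kx ky))

/-- `g` is the weak derivative `∂ᵢ f` (in the horizontally periodic layer). -/
def IsWeakDeriv (kx ky : ℝ) (i : Fin 3) (f g : Field3) : Prop :=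
  ∀ ψ, IsTest kx ky ψ →
    ∫ p in cell kx ky, f p * pderiv i ψ p = -∫ p in cell kx ky, g p * ψ p

/-- `f` has a weak derivative `∂ᵢ f` in `L²` of the cell. -/
def WeakDifferentiable (kx ky : ℝ) (i : Fin 3) (f : Field3) : Prop :=
  ∃ g, MemL2 kx ky g ∧ IsWeakDeriv kx ky i f g

open Classical in
/-- The `L²` weak derivative `∂ᵢ f`, which is unique almost everywhere on the cell
(and `0` by convention where there is none). -/
def wderiv (kx ky : ℝ) (i : Fin 3) (f : Field3) : Field3 :=
  if h : WeakDifferentiable kx ky i f then h.choose else 0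

/-- The horizontally periodic Sobolev space `W^{m,2}` of the cell. -/
def MemW (kx ky : ℝ) : ℕ → Field3 → Prop
  | 0, f => MemL2 kx ky f
  | m + 1, f => MemL2 kx ky f ∧
      ∀ i, WeakDifferentiable kx ky i f ∧ MemW kx ky m (wderiv kx ky i f)

/-- For `f` in `W^{1,2}`: the trace of `f` on the walls `z = 0` and `z = 1` is zero. By Green's
formula `∫ (f ∂_z ψ + (∂_z f) ψ) = ∫_{z=1} f ψ - ∫_{z=0} f ψ`, with `ψ` arbitrary on the walls,
this says that the boundary terms are absent. -/
def VanishesOnWalls (kx ky : ℝ) (f : Field3) : Prop :=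
  ∀ ψ, IsPeriodicSmooth kx ky ψ →
    ∫ p in cell kx ky, f p * pderiv 2 ψ p = -∫ p in cell kx ky, wderiv kx ky 2 f p * ψ p

/-- The Laplacian `Δ`. -/
def lap (kx ky : ℝ) (f : Field3) : Field3 :=
  fun p => ∑ i, wderiv kx ky i (wderiv kx ky i f) p

/-- The horizontal Laplacian `Δ₁ = ∂_x² + ∂_y²`. -/
def hlap (kx ky : ℝ) (f : Field3) : Field3 :=
  fun p => wderiv kx ky 0 (wderiv kx ky 0 f) p + wderiv kx ky 1 (wderiv kx ky 1 f) p

/-- The operator `L = Δ - Da ΔΔ`. -/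
def opL (kx ky Da : ℝ) (f : Field3) : Field3 :=
  fun p => lap kx ky f p - Da * lap kx ky (lap kx ky f) p

/-- `(u, π, θ, φ)` is the spatial part of a nontrivial normal mode
`(u, π, θ, φ) e^{σ t}` of the linearised perturbation equations
`u = -∇π - Ra M(z) θ k + Da Δu`, `∇·u = 0`, `∂_t θ + Ra w = Δθ + H (φ - θ)`,
`A ∂_t φ = Δφ - H γ (φ - θ)`, where `M(z) = ζ - z` and `w = u 2`, with the stress-free
boundary conditions `∂_z u = ∂_z v = w = θ = φ = 0` on `z = 0, 1`.
A mode in which only the pressure differs from zero is trivial: constants solve the equations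
for every `σ`. -/
structure IsNormalMode (kx ky Ra Da ζ H A γ : ℝ) (σ : ℂ)
    (u : Fin 3 → Field3) (π θ φ : Field3) : Prop where
  velocity_mem : ∀ i, MemW kx ky 2 (u i)
  pressure_mem : MemW kx ky 2 π
  theta_mem : MemW kx ky 2 θ
  phi_mem : MemW kx ky 2 φ
  momentum : ∀ i, ∀ᵐ p ∂(volume.restrict (cell kx ky)),
    u i p = -wderiv kx ky i π p
      - (if i = 2 then (Ra : ℂ) * ((ζ - p 2 : ℝ) : ℂ) * θ p else 0)
      + Da * lap kx ky (u i) p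
  div_free : ∀ᵐ p ∂(volume.restrict (cell kx ky)), ∑ i, wderiv kx ky i (u i) p = 0
  fluid_temp : ∀ᵐ p ∂(volume.restrict (cell kx ky)),
    σ * θ p + Ra * u 2 p = lap kx ky θ p + H * (φ p - θ p)
  solid_temp : ∀ᵐ p ∂(volume.restrict (cell kx ky)),
    A * (σ * φ p) = lap kx ky φ p - H * γ * (φ p - θ p)
  bc_u : VanishesOnWalls kx ky (wderiv kx ky 2 (u 0))
  bc_v : VanishesOnWalls kx ky (wderiv kx ky 2 (u 1))
  bc_w : VanishesOnWalls kx ky (u 2)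
  bc_theta : VanishesOnWalls kx ky θ
  bc_phi : VanishesOnWalls kx ky φ
  nontrivial : ¬ ∀ᵐ p ∂(volume.restrict (cell kx ky)), (∀ i, u i p = 0) ∧ θ p = 0 ∧ φ p = 0

/-- `(w, θ, φ)` is a nontrivial solution of the reduced eigenvalue problem, obtained by taking
the third component of the double curl of the momentum equation:
`L w = -Ra M(z) Δ₁ θ`, `σ θ + Ra w = Δθ + H (φ - θ)`,
`σ (A/γ) φ = (1/γ) Δφ - H (φ - θ)`, with `w = ∂_z² w = θ = φ = 0` on `z = 0, 1`. -/
structure IsReducedMode (kx ky Ra Da ζ H A γ : ℝ) (σ : ℂ) (w θ φ : Field3) : Prop where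
  w_mem : MemW kx ky 4 w
  theta_mem : MemW kx ky 2 θ
  phi_mem : MemW kx ky 2 φ
  vertical : ∀ᵐ p ∂(volume.restrict (cell kx ky)),
    opL kx ky Da w p = -((Ra : ℂ) * ((ζ - p 2 : ℝ) : ℂ) * hlap kx ky θ p)
  fluid_temp : ∀ᵐ p ∂(volume.restrict (cell kx ky)),
    σ * θ p + Ra * w p = lap kx ky θ p + H * (φ p - θ p)
  solid_temp : ∀ᵐ p ∂(volume.restrict (cell kx ky)),
    σ * (A / γ) * φ p = 1 / γ * lap kx ky φ p - H * (φ p - θ p)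
  bc_w : VanishesOnWalls kx ky w
  bc_wzz : VanishesOnWalls kx ky (wderiv kx ky 2 (wderiv kx ky 2 w))
  bc_theta : VanishesOnWalls kx ky θ
  bc_phi : VanishesOnWalls kx ky φ
  nontrivial : ¬ ∀ᵐ p ∂(volume.restrict (cell kx ky)), w p = 0 ∧ θ p = 0 ∧ φ p = 0

/-- `σ` is a temporal growth rate of the linearised problem. -/
def IsGrowthRate (kx ky Ra Da ζ H A γ : ℝ) (σ : ℂ) : Prop :=
  ∃ (u : Fin 3 → Field3) (π θ φ : Field3), IsNormalMode kx ky Ra Da ζ H A γ σ u π θ φ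

/-- `σ` is an eigenvalue of the reduced problem for `(w, θ, φ)`. -/
def IsReducedGrowthRate (kx ky Ra Da ζ H A γ : ℝ) (σ : ℂ) : Prop :=
  ∃ w θ φ : Field3, IsReducedMode kx ky Ra Da ζ H A γ σ w θ φ

end Penetrative

end

/-! Expand `w`, `θ`, `φ` in vertical sines and `u`, `v`, `π` in vertical cosines, with horizontal
plane waves. The wall conditions are exactly those for which every derivative in the equations acts
on coefficients as a multiplier; `Δ` becomes `-k²`. Only multiplication by `M(z)` is not diagonal,
but it commutes with horizontal derivatives.

Write `a`, `b`, `w`, `m` for the sine coefficients of `θ`, `φ`, `w`, `M θ`, put `K = (1 + Da k²) k²`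
and let `h` be the squared horizontal wave number. The vertical equation reads `K w = -Ra h m`. For
the normal mode it comes from eliminating the pressure in each mode separately, because `W^{2,2}`
velocities are not regular enough to take the double curl directly. Weight the heat equations by `γ
K conj a` and `K conj b`, add them and take imaginary parts. The exchange terms in `H` cancel by
symmetry, leaving `mode_identity`: `σ.im * K (γ|a|² + A|b|²) = γ Ra² h Im (m conj a)`. Summed over
all modes, the right side is by Parseval a multiple of the imaginary part of `∫ M |∇₁θ|²`, which is
real whatever the sign of `M`. The sum on the left therefore vanishes although its terms, apart from
the factor `σ.im`, are nonnegative. If `σ.im ≠ 0`, all `a` and `b` are zero, then so are `w` and the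
horizontal velocity, contradicting nontriviality.

The analytic work lies in Parseval for the sine and cosine systems (reflection to a torus) and in
testing weak derivatives with modes that do not vanish near the walls (cutoffs). -/

noncomputable section

namespace Penetrative

open Complex ComplexConjugate Set

/-! ### Parseval on the unit torus -/

section Torus

local instance : MeasureSpace UnitAddCircle := ⟨AddCircle.haarAddCircle⟩

/-- **Parseval's identity** on a unit box. -/
theorem hasSum_box_parseval {d : Type*} [Fintype d] (a : d → ℝ) {G H : (d → ℝ) → ℂ}
    (hG : MemLp G 2 (volume.restrict {x | ∀ i, x i ∈ Ioc (a i) (a i + 1)}))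
    (hH : MemLp H 2 (volume.restrict {x | ∀ i, x i ∈ Ioc (a i) (a i + 1)})) :
    HasSum (fun n : d → ℤ =>
      (∫ x in {x | ∀ i, x i ∈ Ioc (a i) (a i + 1)},
        (∏ i, cexp (-(2 * Real.pi * I * n i * x i))) * G x) *
      conj (∫ x in {x | ∀ i, x i ∈ Ioc (a i) (a i + 1)},
        (∏ i, cexp (-(2 * Real.pi * I * n i * x i))) * H x))
      (∫ x in {x | ∀ i, x i ∈ Ioc (a i) (a i + 1)}, G x * conj (H x)) := by
  set B : Set (d → ℝ) := {x | ∀ i, x i ∈ Ioc (a i) (a i + 1)} with hB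
  have hBm : MeasurableSet B := MeasurableSet.univ_pi' fun i => measurableSet_Ioc
  have lift_mem : ∀ {G : (d → ℝ) → ℂ}, MemLp G 2 (volume.restrict B) →
      MemLp (fun x : UnitAddTorus d => G (UnitAddTorus.measurableEquivPiIoc a x).1) 2 volume := by
    intro G hG
    have h1 : MemLp (G ∘ (Subtype.val : B → d → ℝ)) 2 (Measure.comap Subtype.val volume) := by
      rw [← (MeasurableEmbedding.subtype_coe hBm).memLp_map_measure_iff,
        map_comap_subtype_coe hBm]
      exact hG
    exact h1.comp_measurePreserving (UnitAddTorus.measurePreserving_equivPiIoc a)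
  have lift_coe : ∀ (G : (d → ℝ) → ℂ), ∀ x ∈ B,
      G (UnitAddTorus.measurableEquivPiIoc a (fun i => (x i : UnitAddCircle))).1 = G x := by
    intro G x hx
    have := (UnitAddTorus.measurableEquivPiIoc a).apply_symm_apply (⟨x, hx⟩ : B)
    rw [UnitAddTorus.coe_symm_measurableEquivPiIoc_apply] at this
    rw [this]
  have coeff : ∀ {G : (d → ℝ) → ℂ} (hG : MemLp G 2 (volume.restrict B)) (n : d → ℤ),
      UnitAddTorus.mFourierCoeff ((lift_mem hG).toLp _) n =
        ∫ x in B, (∏ i, cexp (-(2 * Real.pi * I * n i * x i))) * G x := by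
    intro G hG n
    have h1 : UnitAddTorus.mFourierCoeff ((lift_mem hG).toLp _) n =
        UnitAddTorus.mFourierCoeff
          (fun x : UnitAddTorus d => G (UnitAddTorus.measurableEquivPiIoc a x).1) n := by
      refine integral_congr_ae ?_
      filter_upwards [(lift_mem hG).coeFn_toLp] with x hx
      rw [hx]
    rw [h1, UnitAddTorus.mFourierCoeff_eq_integral _ _ a]
    refine setIntegral_congr_fun hBm fun x hx => ?_
    simp only [lift_coe G x hx, smul_eq_mul, UnitAddTorus.mFourier, ContinuousMap.coe_mk,
      fourier_coe_apply, Pi.neg_apply]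
    congr 1
    refine Finset.prod_congr rfl fun i _ => ?_
    push_cast
    congr 1
    ring
  -- The torus identity conjugates its first argument, hence `H` before `G`.
  have key := UnitAddTorus.hasSum_prod_mFourierCoeff ((lift_mem hH).toLp _) ((lift_mem hG).toLp _)
  convert! key using 1
  · ext n
    rw [mul_comm, ← coeff hG n, ← coeff hH n]
  · trans ∫ x : UnitAddTorus d, G (UnitAddTorus.measurableEquivPiIoc a x).1 *
      conj (H (UnitAddTorus.measurableEquivPiIoc a x).1)
    · rw [UnitAddTorus.integral_preimage _ a]
      refine setIntegral_congr_fun hBm fun x hx => ?_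
      simp only [lift_coe G x hx, lift_coe H x hx]
    · refine integral_congr_ae ?_
      filter_upwards [(lift_mem hG).coeFn_toLp, (lift_mem hH).coeFn_toLp] with x hx hx'
      rw [hx, hx', mul_comm]

end Torus

/-! ### Rescaling and reflection: from the cell to the torus -/

/-- Rescaling of the coordinates. -/
def scaling (D : Fin 3 → ℝ) (t : Fin 3 → ℝ) : Fin 3 → ℝ := fun i => D i * t i

theorem map_scaling_volume {D : Fin 3 → ℝ} (hD : ∀ i, D i ≠ 0) :
    Measure.map (scaling D) volume = ENNReal.ofReal |∏ i, D i|⁻¹ • volume := by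
  have hdet : (Matrix.diagonal D).det ≠ 0 := by
    rw [Matrix.det_diagonal]
    exact Finset.prod_ne_zero_iff.mpr fun i _ => hD i
  have h := Real.map_matrix_volume_pi_eq_smul_volume_pi hdet
  have hs : ⇑(Matrix.toLin' (Matrix.diagonal D)) = scaling D := by
    ext t i
    simp [scaling, Matrix.mulVec_diagonal]
  rw [hs, Matrix.det_diagonal, abs_inv] at h
  exact h

theorem measurableEmbedding_scaling {D : Fin 3 → ℝ} (hD : ∀ i, D i ≠ 0) :
    MeasurableEmbedding (scaling D) := by
  refine Topology.IsClosedEmbedding.measurableEmbedding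
    (Homeomorph.mk ⟨scaling D, scaling D⁻¹, ?_, ?_⟩ ?_ ?_).isClosedEmbedding
  · intro t; ext i; simp [scaling, hD i]
  · intro t; ext i; simp [scaling, hD i]
  · exact continuous_pi fun i => (continuous_apply i).const_mul _
  · exact continuous_pi fun i => (continuous_apply i).const_mul _

theorem setIntegral_scaling {D : Fin 3 → ℝ} (hD : ∀ i, D i ≠ 0) (s : Set (Fin 3 → ℝ))
    (h : (Fin 3 → ℝ) → ℂ) :
    ∫ t in scaling D ⁻¹' s, h (scaling D t) = ((|∏ i, D i|⁻¹ : ℝ) : ℂ) * ∫ p in s, h p := by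
  have h1 := (measurableEmbedding_scaling hD).setIntegral_map (μ := volume) h s
  rw [← h1, map_scaling_volume hD, Measure.restrict_smul, integral_smul_measure,
    ENNReal.toReal_ofReal (by positivity), Complex.real_smul]

theorem memLp_comp_scaling {D : Fin 3 → ℝ} (hD : ∀ i, D i ≠ 0) {s : Set (Fin 3 → ℝ)}
    (hs : MeasurableSet s) {h : (Fin 3 → ℝ) → ℂ} {q : ENNReal}
    (hh : MemLp h q (volume.restrict s)) :
    MemLp (fun t => h (scaling D t)) q (volume.restrict (scaling D ⁻¹' s)) := by
  have h1 : MemLp h q (Measure.map (scaling D) (volume.restrict (scaling D ⁻¹' s))) := by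
    rw [← Measure.restrict_map (measurableEmbedding_scaling hD).measurable hs,
      map_scaling_volume hD, Measure.restrict_smul]
    exact hh.smul_measure ENNReal.ofReal_ne_top
  exact ((measurableEmbedding_scaling hD).memLp_map_measure_iff).mp h1

/-- Wave numbers of the cell, doubled in the vertical direction by reflection. -/
def waveNumber (kx ky : ℝ) (n : Fin 3 → ℤ) : Fin 3 → ℝ := ![kx * n 0, ky * n 1, Real.pi * n 2]

/-- A plane wave symmetrised (`ε = 1`) or antisymmetrised (`ε = -1`) in the vertical. -/
def mode (kx ky : ℝ) (ε : ℂ) (n : Fin 3 → ℤ) : Field3 := fun p =>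
  cexp (-(I * (waveNumber kx ky n 0 * p 0 + waveNumber kx ky n 1 * p 1
    + waveNumber kx ky n 2 * p 2))) +
  ε * cexp (-(I * (waveNumber kx ky n 0 * p 0 + waveNumber kx ky n 1 * p 1
    - waveNumber kx ky n 2 * p 2)))

/-- The cosine (`ε = 1`) or sine (`ε = -1`) Fourier coefficients on the cell. -/
def coef (kx ky : ℝ) (ε : ℂ) (f : Field3) (n : Fin 3 → ℤ) : ℂ :=
  ∫ p in cell kx ky, f p * mode kx ky ε n p

variable {kx ky : ℝ}

/-- The unit box that two reflected copies of the cell tile after rescaling. -/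
def doubledBox : Set (Fin 3 → ℝ) :=
  {x | ∀ i, x i ∈ Ioc ((![0, 0, -1 / 2] : Fin 3 → ℝ) i) ((![0, 0, -1 / 2] : Fin 3 → ℝ) i + 1)}

/-- Scaling factors from the upper half of the doubled box to the cell. -/
def upperScale (kx ky : ℝ) : Fin 3 → ℝ := ![2 * Real.pi / kx, 2 * Real.pi / ky, 2]

/-- Scaling factors from the lower half of the doubled box to the cell. -/
def lowerScale (kx ky : ℝ) : Fin 3 → ℝ := ![2 * Real.pi / kx, 2 * Real.pi / ky, -2]

/-- The upper half space. -/
def upperHalf : Set (Fin 3 → ℝ) := {t | 0 < t 2}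

theorem measurableSet_doubledBox : MeasurableSet doubledBox :=
  MeasurableSet.univ_pi' fun _ => measurableSet_Ioc

theorem measurableSet_upperHalf : MeasurableSet upperHalf :=
  measurableSet_lt measurable_const (measurable_pi_apply 2)

theorem measurableSet_cell : MeasurableSet (cell kx ky) := measurableSet_Icc

theorem isCompact_cell : IsCompact (cell kx ky) := isCompact_Icc

instance : IsFiniteMeasure (volume.restrict (cell kx ky)) :=
  ⟨by rw [Measure.restrict_apply_univ]; exact isCompact_cell.measure_lt_top⟩

theorem upperScale_ne_zero (hkx : 0 < kx) (hky : 0 < ky) (i : Fin 3) : upperScale kx ky i ≠ 0 := by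
  fin_cases i <;> simp [upperScale, hkx.ne', hky.ne']

theorem lowerScale_ne_zero (hkx : 0 < kx) (hky : 0 < ky) (i : Fin 3) : lowerScale kx ky i ≠ 0 := by
  fin_cases i <;> simp [lowerScale, hkx.ne', hky.ne']

theorem forall_fin_three {P : Fin 3 → Prop} : (∀ i, P i) ↔ P 0 ∧ P 1 ∧ P 2 := by
  simp [Fin.forall_fin_succ]

/-- The half-open box and the closed preimage differ only in faces, which are null sets. -/
theorem upper_preimage_ae (hkx : 0 < kx) (hky : 0 < ky) :
    (doubledBox ∩ upperHalf : Set (Fin 3 → ℝ)) =ᵐ[volume]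
      scaling (upperScale kx ky) ⁻¹' cell kx ky := by
  have hpi := Real.pi_pos
  have hx : 0 < 2 * Real.pi / kx := by positivity
  have hy : 0 < 2 * Real.pi / ky := by positivity
  have h1 : (doubledBox ∩ upperHalf : Set (Fin 3 → ℝ)) =
      Set.pi univ fun i => Ioc ((0 : Fin 3 → ℝ) i) ((![1, 1, 1 / 2] : Fin 3 → ℝ) i) := by
    ext t
    simp only [doubledBox, upperHalf, mem_inter_iff, mem_ofPred_eq, mem_pi, forall_fin_three,
      mem_Ioc, Matrix.cons_val, Pi.zero_apply]
    grind
  have h2 : scaling (upperScale kx ky) ⁻¹' cell kx ky = Icc 0 ![1, 1, 1 / 2] := by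
    ext t
    simp only [scaling, upperScale, cell, mem_preimage, mem_Icc, Pi.le_def, forall_fin_three]
    simp [mul_nonneg_iff_of_pos_left hx, mul_nonneg_iff_of_pos_left hy, mul_le_iff_le_one_right hx,
      mul_le_iff_le_one_right hy]
    grind
  rw [h1, h2]
  exact Measure.univ_pi_Ioc_ae_eq_Icc

theorem lower_preimage_ae (hkx : 0 < kx) (hky : 0 < ky) :
    (doubledBox \ upperHalf : Set (Fin 3 → ℝ)) =ᵐ[volume]
      scaling (lowerScale kx ky) ⁻¹' cell kx ky := by
  have hpi := Real.pi_pos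
  have hx : 0 < 2 * Real.pi / kx := by positivity
  have hy : 0 < 2 * Real.pi / ky := by positivity
  have h1 : (doubledBox \ upperHalf : Set (Fin 3 → ℝ)) =
      Set.pi univ fun i => Ioc ((![0, 0, -1 / 2] : Fin 3 → ℝ) i) ((![1, 1, 0] : Fin 3 → ℝ) i) := by
    ext t
    simp only [doubledBox, upperHalf, mem_sdiff, mem_ofPred_eq, mem_pi, forall_fin_three,
      mem_Ioc, Matrix.cons_val]
    grind
  have h2 : scaling (lowerScale kx ky) ⁻¹' cell kx ky = Icc ![0, 0, -1 / 2] ![1, 1, 0] := by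
    ext t
    simp only [scaling, lowerScale, cell, mem_preimage, mem_Icc, Pi.le_def, forall_fin_three]
    simp [mul_nonneg_iff_of_pos_left hx, mul_nonneg_iff_of_pos_left hy, mul_le_iff_le_one_right hx,
      mul_le_iff_le_one_right hy]
    grind
  rw [h1, h2]
  exact Measure.univ_pi_Ioc_ae_eq_Icc

open Classical in
/-- A field on the doubled box given by two fields on the cell. -/
def unfold (kx ky : ℝ) (P Q : Field3) : Field3 :=
  upperHalf.piecewise (fun t => P (scaling (upperScale kx ky) t))
    (fun t => Q (scaling (lowerScale kx ky) t))

theorem unfold_of_mem {P Q : Field3} {t : Fin 3 → ℝ} (ht : t ∈ upperHalf) :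
    unfold kx ky P Q t = P (scaling (upperScale kx ky) t) := by
  classical exact piecewise_eq_of_mem _ _ _ ht

theorem unfold_of_notMem {P Q : Field3} {t : Fin 3 → ℝ} (ht : t ∉ upperHalf) :
    unfold kx ky P Q t = Q (scaling (lowerScale kx ky) t) := by
  classical exact piecewise_eq_of_notMem _ _ _ ht

theorem memLp_unfold (hkx : 0 < kx) (hky : 0 < ky) {P Q : Field3} {q : ENNReal}
    (hP : MemLp P q (volume.restrict (cell kx ky)))
    (hQ : MemLp Q q (volume.restrict (cell kx ky))) :
    MemLp (unfold kx ky P Q) q (volume.restrict doubledBox) := by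
  classical
  refine MemLp.piecewise measurableSet_upperHalf ?_ ?_
  · rw [Measure.restrict_restrict measurableSet_upperHalf, inter_comm,
      Measure.restrict_congr_set (upper_preimage_ae hkx hky)]
    exact memLp_comp_scaling (upperScale_ne_zero hkx hky) measurableSet_cell hP
  · rw [Measure.restrict_restrict measurableSet_upperHalf.compl, inter_comm, ← sdiff_eq,
      Measure.restrict_congr_set (lower_preimage_ae hkx hky)]
    exact memLp_comp_scaling (lowerScale_ne_zero hkx hky) measurableSet_cell hQ

/-- Both halves are affine copies of the cell with the same Jacobian; the sign of the reflection is
lost in the absolute value. -/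
theorem setIntegral_unfold (hkx : 0 < kx) (hky : 0 < ky) {P Q : Field3}
    (hP : IntegrableOn P (cell kx ky)) (hQ : IntegrableOn Q (cell kx ky)) :
    ∫ t in doubledBox, unfold kx ky P Q t =
      ((kx * ky / (8 * Real.pi ^ 2) : ℝ) : ℂ) *
        ((∫ p in cell kx ky, P p) + ∫ p in cell kx ky, Q p) := by
  have hpi := Real.pi_pos
  have hint : IntegrableOn (unfold kx ky P Q) doubledBox :=
    memLp_one_iff_integrable.mp (memLp_unfold hkx hky (memLp_one_iff_integrable.mpr hP)
      (memLp_one_iff_integrable.mpr hQ))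
  rw [← integral_inter_add_sdiff measurableSet_upperHalf hint]
  have h1 : ∫ t in doubledBox ∩ upperHalf, unfold kx ky P Q t =
      ∫ t in doubledBox ∩ upperHalf, P (scaling (upperScale kx ky) t) :=
    setIntegral_congr_fun (measurableSet_doubledBox.inter measurableSet_upperHalf)
      fun t ht => unfold_of_mem ht.2
  have h2 : ∫ t in doubledBox \ upperHalf, unfold kx ky P Q t =
      ∫ t in doubledBox \ upperHalf, Q (scaling (lowerScale kx ky) t) :=
    setIntegral_congr_fun (measurableSet_doubledBox.diff measurableSet_upperHalf)
      fun t ht => unfold_of_notMem ht.2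
  rw [h1, h2, setIntegral_congr_set (upper_preimage_ae hkx hky),
    setIntegral_congr_set (lower_preimage_ae hkx hky),
    setIntegral_scaling (upperScale_ne_zero hkx hky),
    setIntegral_scaling (lowerScale_ne_zero hkx hky), mul_add]
  have h3 : |∏ i, upperScale kx ky i|⁻¹ = kx * ky / (8 * Real.pi ^ 2) := by
    rw [Fin.prod_univ_three]
    simp only [upperScale, Matrix.cons_val]
    rw [abs_of_pos (by positivity)]
    field_simp
    norm_num
  have h4 : |∏ i, lowerScale kx ky i|⁻¹ = kx * ky / (8 * Real.pi ^ 2) := by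
    rw [← h3, Fin.prod_univ_three, Fin.prod_univ_three]
    simp [upperScale, lowerScale]
  rw [h3, h4]

theorem continuous_mode (ε : ℂ) (n : Fin 3 → ℤ) : Continuous (mode kx ky ε n) := by
  have (i : Fin 3) : Continuous fun p : Fin 3 → ℝ => (p i : ℂ) := by fun_prop
  unfold mode
  fun_prop

theorem MemL2.integrableOn {f : Field3} (hf : MemL2 kx ky f) : IntegrableOn f (cell kx ky) :=
  hf.2.integrable (by norm_num)

theorem integrableOn_mul_continuous {f ψ : Field3} (hf : IntegrableOn f (cell kx ky))
    (hψ : Continuous ψ) : IntegrableOn (fun p => f p * ψ p) (cell kx ky) :=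
  hf.mul_continuousOn hψ.continuousOn isCompact_cell

theorem integrableOn_mul_conj {f g : Field3} (hf : MemL2 kx ky f) (hg : MemL2 kx ky g) :
    IntegrableOn (fun p => f p * conj (g p)) (cell kx ky) :=
  hf.2.integrable_mul hg.2.star

/-- Reflecting the lower half back to the cell turns its exponential into the second term of `mode`.
The full Fourier coefficients of the even or odd extension are thus the half-range coefficients of
`f`. -/
theorem box_coeff_unfold (hkx : 0 < kx) (hky : 0 < ky) {f : Field3} (hf : MemL2 kx ky f)
    (ε : ℂ) (n : Fin 3 → ℤ) :
    ∫ x in doubledBox, (∏ i, cexp (-(2 * Real.pi * I * n i * x i))) *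
      unfold kx ky f (fun p => ε * f p) x =
      ((kx * ky / (8 * Real.pi ^ 2) : ℝ) : ℂ) * coef kx ky ε f n := by
  have hkx' : (kx : ℂ) ≠ 0 := by exact_mod_cast hkx.ne'
  have hky' : (ky : ℂ) ≠ 0 := by exact_mod_cast hky.ne'
  set P : Field3 := fun p => f p * cexp (-(I * (waveNumber kx ky n 0 * p 0
    + waveNumber kx ky n 1 * p 1 + waveNumber kx ky n 2 * p 2))) with hP
  set Q : Field3 := fun p => f p * (ε * cexp (-(I * (waveNumber kx ky n 0 * p 0
    + waveNumber kx ky n 1 * p 1 - waveNumber kx ky n 2 * p 2)))) with hQ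
  have hPi : IntegrableOn P (cell kx ky) :=
    integrableOn_mul_continuous hf.integrableOn (by fun_prop)
  have hQi : IntegrableOn Q (cell kx ky) :=
    integrableOn_mul_continuous hf.integrableOn (by fun_prop)
  have h1 : ∀ x, (∏ i, cexp (-(2 * Real.pi * I * n i * x i))) *
      unfold kx ky f (fun p => ε * f p) x = unfold kx ky P Q x := by
    intro x
    rw [← Complex.exp_sum, Fin.sum_univ_three]
    by_cases hx : x ∈ upperHalf
    · simp only [unfold_of_mem hx, hP]
      rw [mul_comm]
      congr 2
      simp only [waveNumber, scaling, upperScale, Matrix.cons_val]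
      push_cast
      field_simp
      ring
    · simp only [unfold_of_notMem hx, hQ]
      rw [mul_comm, mul_comm ε, mul_assoc]
      congr 3
      simp only [waveNumber, scaling, lowerScale, Matrix.cons_val]
      push_cast
      field_simp
      ring
  simp_rw [h1]
  rw [setIntegral_unfold hkx hky hPi hQi, ← integral_add hPi hQi]
  simp only [coef, mode, hP, hQ, mul_add]

/-- **Parseval's identity** for the sine and cosine coefficients on the cell. -/
theorem hasSum_coef_parseval (hkx : 0 < kx) (hky : 0 < ky) {ε : ℂ} (hε : ε * conj ε = 1)
    {f g : Field3} (hf : MemL2 kx ky f) (hg : MemL2 kx ky g) :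
    HasSum (fun n => coef kx ky ε f n * conj (coef kx ky ε g n))
      ((16 * Real.pi ^ 2 / (kx * ky) : ℝ) * ∫ p in cell kx ky, f p * conj (g p)) := by
  have hpi := Real.pi_pos
  have hc : kx * ky / (8 * Real.pi ^ 2) ≠ 0 := by positivity
  set c : ℝ := kx * ky / (8 * Real.pi ^ 2) with hcdef
  have hc' : (c : ℂ) ≠ 0 := by exact_mod_cast hc
  have h := hasSum_box_parseval ![0, 0, -1 / 2]
    (memLp_unfold hkx hky hf.2 (hf.2.const_mul ε)) (memLp_unfold hkx hky hg.2 (hg.2.const_mul ε))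
  change HasSum (fun n => (∫ x in doubledBox, _) * conj (∫ x in doubledBox, _))
    (∫ x in doubledBox, _) at h
  simp only [box_coeff_unfold hkx hky hf, box_coeff_unfold hkx hky hg, ← hcdef] at h
  -- Since `ε` is unimodular, the two halves contribute equally to the inner product.
  have h2 : ∀ x, unfold kx ky f (fun p => ε * f p) x * conj (unfold kx ky g (fun p => ε * g p) x) =
      unfold kx ky (fun p => f p * conj (g p)) (fun p => f p * conj (g p)) x := by
    intro x
    by_cases hx : x ∈ upperHalf
    · simp only [unfold_of_mem hx]
    · simp only [unfold_of_notMem hx, map_mul]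
      linear_combination (f (scaling (lowerScale kx ky) x) *
        conj (g (scaling (lowerScale kx ky) x))) * hε
  simp only [h2] at h
  rw [setIntegral_unfold hkx hky (integrableOn_mul_conj hf hg) (integrableOn_mul_conj hf hg),
    ← hcdef] at h
  -- Each coefficient carries a factor `c` and the box integral equals `2 c` times that over the
  -- cell, so the constant is `2 / c`.
  convert! h.mul_left ((c : ℂ)⁻¹ ^ 2) using 1
  · ext n
    simp only [map_mul, conj_ofReal]
    field_simp
  · have : (16 * Real.pi ^ 2 / (kx * ky) : ℝ) = 2 / c := by
      rw [hcdef]; field_simp; norm_num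
    rw [this]
    push_cast
    field_simp
    ring

/-- A square integrable field with vanishing coefficients vanishes. -/
theorem ae_eq_zero_of_coef (hkx : 0 < kx) (hky : 0 < ky) {ε : ℂ} (hε : ε * conj ε = 1)
    {f : Field3} (hf : MemL2 kx ky f) (h : ∀ n, coef kx ky ε f n = 0) :
    ∀ᵐ p ∂(volume.restrict (cell kx ky)), f p = 0 := by
  have hpi := Real.pi_pos
  have h1 := hasSum_coef_parseval hkx hky hε hf hf
  simp only [h, zero_mul] at h1
  have h2 := h1.unique hasSum_zero
  have h3 : ((16 * Real.pi ^ 2 / (kx * ky) : ℝ) : ℂ) ≠ 0 := by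
    exact_mod_cast (by positivity : (16 * Real.pi ^ 2 / (kx * ky) : ℝ) ≠ 0)
  have h4 := (mul_eq_zero.mp h2).resolve_left h3
  simp only [Complex.mul_conj, integral_complex_ofReal] at h4
  have hi : Integrable (fun p => normSq (f p)) (volume.restrict (cell kx ky)) := by
    have := (integrableOn_mul_conj hf hf).re
    simpa [Complex.mul_conj] using this
  have h5 := (integral_eq_zero_iff_of_nonneg (fun p => normSq_nonneg (f p)) hi).mp
    (by exact_mod_cast h4)
  filter_upwards [h5] with p hp
  exact normSq_eq_zero.mp hp

/-! ### Cutoffs near the walls and admissible test functions -/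

open Filter Topology

theorem deriv_smoothTransition_eq_zero {x : ℝ} (hx : 1 < x) :
    deriv Real.smoothTransition x = 0 := by
  have : Real.smoothTransition =ᶠ[𝓝 x] fun _ => 1 := by
    filter_upwards [lt_mem_nhds hx] with y hy
    exact Real.smoothTransition.one_of_one_le hy.le
  rw [this.deriv_eq, deriv_const]

/-- The derivative vanishes beyond `1`, so only the compact interval `[-1, 1]` matters. At `x = m z
- 1` the weight `x + 1` is `m z`. -/
theorem exists_bound_deriv_smoothTransition :
    ∃ B, ∀ x, -1 ≤ x → |deriv Real.smoothTransition x| * (x + 1) ≤ B := by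
  have hc : Continuous (deriv Real.smoothTransition) :=
    (Real.smoothTransition.contDiff (n := 1)).continuous_deriv le_rfl
  obtain ⟨B, hB⟩ := (isCompact_Icc (a := (-1 : ℝ)) (b := 1)).exists_bound_of_continuousOn
    (f := fun x => |deriv Real.smoothTransition x| * (x + 1)) (by fun_prop)
  refine ⟨max B 0, fun x hx => ?_⟩
  rcases le_or_gt x 1 with h | h
  · exact (le_abs_self _).trans ((hB x ⟨hx, h⟩).trans (le_max_left _ _))
  · simp [deriv_smoothTransition_eq_zero h]

/-- A smooth cutoff that vanishes at distance `1/m` from the walls. -/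
def cutoff (m : ℕ) (z : ℝ) : ℝ :=
  Real.smoothTransition (m * z - 1) * Real.smoothTransition (m * (1 - z) - 1)

/-- The derivative of the cutoff. -/
def cutoffDeriv (m : ℕ) (z : ℝ) : ℝ :=
  m * deriv Real.smoothTransition (m * z - 1) * Real.smoothTransition (m * (1 - z) - 1) -
  Real.smoothTransition (m * z - 1) * (m * deriv Real.smoothTransition (m * (1 - z) - 1))

theorem contDiff_cutoff (m : ℕ) : ContDiff ℝ ∞ (cutoff m) := by
  have h : ContDiff ℝ ∞ Real.smoothTransition := Real.smoothTransition.contDiff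
  unfold cutoff
  exact (h.comp (by fun_prop)).mul (h.comp (by fun_prop))

theorem continuous_cutoffDeriv (m : ℕ) : Continuous (cutoffDeriv m) := by
  have hc : Continuous (deriv Real.smoothTransition) :=
    (Real.smoothTransition.contDiff (n := 1)).continuous_deriv le_rfl
  have h : Continuous Real.smoothTransition := Real.smoothTransition.continuous
  unfold cutoffDeriv
  fun_prop

theorem hasDerivAt_cutoff (m : ℕ) (z : ℝ) : HasDerivAt (cutoff m) (cutoffDeriv m z) z := by
  have h (x : ℝ) : HasDerivAt Real.smoothTransition (deriv Real.smoothTransition x) x :=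
    ((Real.smoothTransition.contDiff (n := 1)).differentiable (by simp) x).hasDerivAt
  have h1 : HasDerivAt (fun z : ℝ => (m : ℝ) * z - 1) m z := by
    simpa using ((hasDerivAt_id z).const_mul (m : ℝ)).sub_const 1
  have h2 : HasDerivAt (fun z : ℝ => (m : ℝ) * (1 - z) - 1) (-m) z := by
    simpa using (((hasDerivAt_id z).const_sub 1).const_mul (m : ℝ)).sub_const 1
  convert! ((h _).comp z h1).mul ((h _).comp z h2) using 1
  simp only [cutoffDeriv, Function.comp]
  ring

/-- The margin uses `m + 1` rather than `m` so that it makes sense for `m = 0` too. -/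
theorem cutoff_eq_zero {m : ℕ} {z : ℝ} (hz : z ∉ Icc (1 / (m + 1 : ℝ)) (1 - 1 / (m + 1 : ℝ))) :
    cutoff m z = 0 := by
  have hm : (0 : ℝ) ≤ m := m.cast_nonneg
  have hm1 : (m + 1 : ℝ) * (1 / (m + 1)) = 1 := by field_simp
  have hd : 0 < 1 / (m + 1 : ℝ) := by positivity
  have key : ∀ y : ℝ, y < 1 / (m + 1 : ℝ) → Real.smoothTransition (m * y - 1) = 0 := by
    intro y hy
    apply Real.smoothTransition.zero_of_nonpos
    nlinarith
  rw [mem_Icc, not_and_or, not_le, not_le] at hz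
  rcases hz with h | h
  · simp [cutoff, key z h]
  · simp [cutoff, key (1 - z) (by linarith)]

theorem cutoff_mem_Icc (m : ℕ) (z : ℝ) : cutoff m z ∈ Icc (0 : ℝ) 1 :=
  ⟨mul_nonneg (Real.smoothTransition.nonneg _) (Real.smoothTransition.nonneg _),
    mul_le_one₀ (Real.smoothTransition.le_one _) (Real.smoothTransition.nonneg _)
      (Real.smoothTransition.le_one _)⟩

theorem eventually_cutoff {z : ℝ} (h0 : 0 < z) (h1 : z < 1) :
    ∀ᶠ m : ℕ in atTop, cutoff m z = 1 ∧ cutoffDeriv m z = 0 := by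
  have key : ∀ y : ℝ, 0 < y → ∀ᶠ m : ℕ in atTop, 1 < m * y - 1 := by
    intro y hy
    have := (tendsto_natCast_atTop_atTop (R := ℝ)).atTop_mul_const hy
    filter_upwards [this.eventually_gt_atTop 2] with m hm
    linarith
  filter_upwards [key z h0, key (1 - z) (by linarith)] with m ha hb
  simp [cutoff, cutoffDeriv, deriv_smoothTransition_eq_zero ha, deriv_smoothTransition_eq_zero hb,
    Real.smoothTransition.one_of_one_le ha.le, Real.smoothTransition.one_of_one_le hb.le]

/-- The derivative has size of order `m`, but only at distance of order `1/m` from a wall.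
Multiplied by the distance to the walls it stays bounded uniformly in `m`; `a` is any lower bound
for both distances. -/
theorem exists_bound_cutoffDeriv :
    ∃ B, ∀ (m : ℕ) (z a : ℝ), z ∈ Icc (0 : ℝ) 1 → a ≤ z → a ≤ 1 - z →
      |cutoffDeriv m z| * a ≤ B := by
  obtain ⟨B, hB⟩ := exists_bound_deriv_smoothTransition
  refine ⟨2 * B, fun m z a hz h1 h2 => ?_⟩
  have hm : (0 : ℝ) ≤ m := m.cast_nonneg
  have key : ∀ y : ℝ, 0 ≤ y → m * |deriv Real.smoothTransition (m * y - 1)| * y ≤ B := by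
    intro y hy
    have := hB (m * y - 1) (by nlinarith)
    linarith
  have hle : |cutoffDeriv m z| ≤ m * |deriv Real.smoothTransition (m * z - 1)| +
      m * |deriv Real.smoothTransition (m * (1 - z) - 1)| := by
    refine (abs_sub _ _).trans ?_
    simp only [abs_mul, Nat.abs_cast, abs_of_nonneg (Real.smoothTransition.nonneg _)]
    refine add_le_add (mul_le_of_le_one_right (by positivity) (Real.smoothTransition.le_one _))
      (mul_le_of_le_one_left (by positivity) (Real.smoothTransition.le_one _))
  rcases le_or_gt a 0 with ha | ha
  · have h0 := (mul_nonneg (mul_nonneg hm (abs_nonneg _)) hz.1).trans (key z hz.1)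
    exact (mul_nonpos_of_nonneg_of_nonpos (abs_nonneg _) ha).trans (by linarith)
  · calc |cutoffDeriv m z| * a ≤ (m * |deriv Real.smoothTransition (m * z - 1)| +
          m * |deriv Real.smoothTransition (m * (1 - z) - 1)|) * a := by gcongr
      _ ≤ m * |deriv Real.smoothTransition (m * z - 1)| * z +
          m * |deriv Real.smoothTransition (m * (1 - z) - 1)| * (1 - z) := by
        rw [add_mul]; gcongr
      _ ≤ 2 * B := by linarith [key z hz.1, key (1 - z) (by linarith [hz.2])]

theorem isTest_cutoff_mul {ψ : Field3} (hψ : IsPeriodicSmooth kx ky ψ) (m : ℕ) :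
    IsTest kx ky fun p => (cutoff m (p 2) : ℂ) * ψ p := by
  refine ⟨⟨?_, ?_, ?_⟩, 1 / (m + 1 : ℝ), by positivity, fun p hp => ?_⟩
  · refine ContDiff.mul ?_ hψ.1
    exact Complex.ofRealCLM.contDiff.comp ((contDiff_cutoff m).comp (contDiff_apply ℝ ℝ 2))
  · intro p
    simp [hψ.2.1 p]
  · intro p
    simp [hψ.2.2 p]
  · simp [cutoff_eq_zero hp]

theorem pderiv_vertical_mul {χ : ℝ → ℝ} {c : ℝ} {ψ : Field3} (hψ : ContDiff ℝ ∞ ψ)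
    {p : Fin 3 → ℝ} (hχ : HasDerivAt χ c (p 2)) (i : Fin 3) :
    pderiv i (fun p => (χ (p 2) : ℂ) * ψ p) p =
      (if i = 2 then (c : ℂ) else 0) * ψ p + (χ (p 2) : ℂ) * pderiv i ψ p := by
  have h0 := HasFDerivAt.comp (f := fun p : Fin 3 → ℝ => p 2) p
    hχ.hasFDerivAt (hasFDerivAt_apply 2 p)
  have h1 : HasFDerivAt (fun p : Fin 3 → ℝ => (χ (p 2) : ℂ))
      (Complex.ofRealCLM.comp ((ContinuousLinearMap.toSpanSingleton ℝ c).comp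
        (ContinuousLinearMap.proj 2))) p :=
    Complex.ofRealCLM.hasFDerivAt.comp p h0
  have h2 : HasFDerivAt ψ (fderiv ℝ ψ p) p := (hψ.differentiable (by simp) p).hasFDerivAt
  rw [pderiv, (h1.fun_mul h2).fderiv, pderiv]
  by_cases hi : i = 2
  · subst hi
    simp
    ring
  · simp [hi]

theorem pderiv_cutoff_mul {ψ : Field3} (hψ : ContDiff ℝ ∞ ψ) (m : ℕ) (i : Fin 3) (p : Fin 3 → ℝ) :
    pderiv i (fun p => (cutoff m (p 2) : ℂ) * ψ p) p =
      (if i = 2 then (cutoffDeriv m (p 2) : ℂ) else 0) * ψ p +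
        (cutoff m (p 2) : ℂ) * pderiv i ψ p :=
  pderiv_vertical_mul hψ (hasDerivAt_cutoff m (p 2)) i

theorem ae_mem_interior : ∀ᵐ p ∂(volume.restrict (cell kx ky)),
    p ∈ cell kx ky ∧ 0 < p 2 ∧ p 2 < 1 := by
  have h1 : ∀ᵐ p ∂(volume.restrict (cell kx ky)), p ∈ cell kx ky :=
    ae_restrict_mem measurableSet_cell
  have h2 : (Set.pi univ fun i => Ioo ((0 : Fin 3 → ℝ) i)
      ((![2 * Real.pi / kx, 2 * Real.pi / ky, 1] : Fin 3 → ℝ) i)) =ᵐ[volume] cell kx ky :=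
    Measure.univ_pi_Ioo_ae_eq_Icc
  have h3 : ∀ᵐ p ∂(volume.restrict (cell kx ky)), p ∈ (Set.pi univ fun i =>
      Ioo ((0 : Fin 3 → ℝ) i) ((![2 * Real.pi / kx, 2 * Real.pi / ky, 1] : Fin 3 → ℝ) i)) := by
    rw [← Measure.restrict_congr_set h2]
    exact ae_restrict_mem (MeasurableSet.univ_pi fun i => measurableSet_Ioo)
  filter_upwards [h1, h3] with p hp hp'
  exact ⟨hp, hp' 2 (mem_univ _)⟩

theorem continuous_pderiv {ψ : Field3} (hψ : ContDiff ℝ ∞ ψ) (i : Fin 3) :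
    Continuous (pderiv i ψ) :=
  (hψ.continuous_fderiv (by simp)).clm_apply continuous_const

/-- Weak derivatives may be tested with periodic smooth functions that do not vanish near the
walls, if the derivative is horizontal or the function is zero on the walls. -/
theorem IsWeakDeriv.integral_eq {i : Fin 3} {f g ψ : Field3} (h : IsWeakDeriv kx ky i f g)
    (hf : IntegrableOn f (cell kx ky)) (hg : IntegrableOn g (cell kx ky))
    (hψ : IsPeriodicSmooth kx ky ψ)
    (hwall : i ≠ 2 ∨ ∃ D, ∀ p ∈ cell kx ky, ‖ψ p‖ ≤ D * p 2 ∧ ‖ψ p‖ ≤ D * (1 - p 2)) :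
    ∫ p in cell kx ky, f p * pderiv i ψ p = -∫ p in cell kx ky, g p * ψ p := by
  have hψc : Continuous ψ := hψ.1.continuous
  have hdc : Continuous (pderiv i ψ) := continuous_pderiv hψ.1 i
  obtain ⟨C₀, hC₀⟩ := (isCompact_cell (kx := kx) (ky := ky)).exists_bound_of_continuousOn
    hψc.continuousOn
  obtain ⟨C₁, hC₁⟩ := (isCompact_cell (kx := kx) (ky := ky)).exists_bound_of_continuousOn
    hdc.continuousOn
  have hχc (m : ℕ) : Continuous fun p : Fin 3 → ℝ => (cutoff m (p 2) : ℂ) :=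
    Complex.continuous_ofReal.comp ((contDiff_cutoff m).continuous.comp (continuous_apply 2))
  have hχd (m : ℕ) : Continuous fun p : Fin 3 → ℝ => (cutoffDeriv m (p 2) : ℂ) :=
    Complex.continuous_ofReal.comp ((continuous_cutoffDeriv m).comp (continuous_apply 2))
  -- The only term that could blow up contains `cutoffDeriv`. It is absent for horizontal
  -- derivatives, and for `i = 2` the linear vanishing of `ψ` at the walls compensates it. Dominated
  -- convergence then removes the cutoff.
  have hE : ∃ C₂, ∀ (m : ℕ), ∀ p ∈ cell kx ky,
      ‖(if i = 2 then (cutoffDeriv m (p 2) : ℂ) else 0) * ψ p‖ ≤ C₂ := by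
    by_cases hi : i = 2
    · obtain ⟨D, hD⟩ := hwall.resolve_left (not_not.mpr hi)
      obtain ⟨B, hB⟩ := exists_bound_cutoffDeriv
      refine ⟨|D| * B, fun m p hp => ?_⟩
      have hz : p 2 ∈ Icc (0 : ℝ) 1 := ⟨hp.1 2, hp.2 2⟩
      rw [if_pos hi, norm_mul, Complex.norm_real, Real.norm_eq_abs]
      have h1 : ‖ψ p‖ ≤ |D| * min (p 2) (1 - p 2) := by
        rw [mul_min_of_nonneg _ _ (abs_nonneg D)]
        refine le_min ((hD p hp).1.trans ?_) ((hD p hp).2.trans ?_)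
        · exact mul_le_mul_of_nonneg_right (le_abs_self D) hz.1
        · exact mul_le_mul_of_nonneg_right (le_abs_self D) (by linarith [hz.2])
      calc |cutoffDeriv m (p 2)| * ‖ψ p‖
          ≤ |cutoffDeriv m (p 2)| * (|D| * min (p 2) (1 - p 2)) := by gcongr
        _ = |D| * (|cutoffDeriv m (p 2)| * min (p 2) (1 - p 2)) := by ring
        _ ≤ |D| * B := by
          gcongr
          exact hB m (p 2) _ hz (min_le_left _ _) (min_le_right _ _)
    · exact ⟨0, fun m p _ => by simp [hi]⟩
  obtain ⟨C₂, hC₂⟩ := hE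
  have hL : Tendsto (fun m : ℕ => ∫ p in cell kx ky,
      f p * pderiv i (fun p => (cutoff m (p 2) : ℂ) * ψ p) p) atTop
      (𝓝 (∫ p in cell kx ky, f p * pderiv i ψ p)) := by
    simp only [pderiv_cutoff_mul hψ.1]
    refine tendsto_integral_of_dominated_convergence (fun p => ‖f p‖ * (C₂ + C₁)) ?_ ?_ ?_ ?_
    · intro m
      refine hf.1.mul (Continuous.aestronglyMeasurable ?_)
      split_ifs
      · exact ((hχd m).mul hψc).add ((hχc m).mul hdc)
      · exact (continuous_const.mul hψc).add ((hχc m).mul hdc)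
    · exact hf.norm.mul_const _
    · intro m
      filter_upwards [ae_mem_interior] with p hp
      rw [norm_mul]
      gcongr
      refine (norm_add_le _ _).trans (add_le_add (hC₂ m p hp.1) ?_)
      rw [norm_mul, Complex.norm_real, Real.norm_eq_abs, abs_of_nonneg (cutoff_mem_Icc m _).1]
      exact (mul_le_of_le_one_left (norm_nonneg _) (cutoff_mem_Icc m _).2).trans (hC₁ p hp.1)
    · filter_upwards [ae_mem_interior] with p hp
      refine tendsto_const_nhds.congr' ?_
      filter_upwards [eventually_cutoff hp.2.1 hp.2.2] with m hm
      simp [hm.1, hm.2]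
  have hR : Tendsto (fun m : ℕ => -∫ p in cell kx ky, g p * ((cutoff m (p 2) : ℂ) * ψ p)) atTop
      (𝓝 (-∫ p in cell kx ky, g p * ψ p)) := by
    refine (tendsto_integral_of_dominated_convergence (fun p => ‖g p‖ * C₀) ?_ ?_ ?_ ?_).neg
    · intro m
      exact hg.1.mul ((hχc m).mul hψc).aestronglyMeasurable
    · exact hg.norm.mul_const _
    · intro m
      filter_upwards [ae_mem_interior] with p hp
      rw [norm_mul]
      gcongr
      rw [norm_mul, Complex.norm_real, Real.norm_eq_abs, abs_of_nonneg (cutoff_mem_Icc m _).1]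
      exact (mul_le_of_le_one_left (norm_nonneg _) (cutoff_mem_Icc m _).2).trans (hC₀ p hp.1)
    · filter_upwards [ae_mem_interior] with p hp
      refine tendsto_const_nhds.congr' ?_
      filter_upwards [eventually_cutoff hp.2.1 hp.2.2] with m hm
      simp [hm.1]
  refine tendsto_nhds_unique hL (hR.congr fun m => ?_)
  exact (h _ (isTest_cutoff_mul hψ m)).symm

/-! ### Derivatives and wall behaviour of the modes -/

theorem hasFDerivAt_wave (a b c : ℝ) (p : Fin 3 → ℝ) (i : Fin 3) :
    ∃ L : (Fin 3 → ℝ) →L[ℝ] ℂ,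
      HasFDerivAt (fun p : Fin 3 → ℝ => cexp (-(I * (a * p 0 + b * p 1 + c * p 2)))) L p ∧
      L (Pi.single i 1) = -(I * (![a, b, c] i : ℝ)) *
        cexp (-(I * (a * p 0 + b * p 1 + c * p 2))) := by
  have hp (j : Fin 3) : HasFDerivAt (fun p : Fin 3 → ℝ => (p j : ℂ))
      (Complex.ofRealCLM.comp (ContinuousLinearMap.proj j)) p :=
    Complex.ofRealCLM.hasFDerivAt.comp p (hasFDerivAt_apply j p)
  refine ⟨_, (((((hp 0).const_mul (a : ℂ)).add ((hp 1).const_mul (b : ℂ))).add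
    ((hp 2).const_mul (c : ℂ))).const_mul I).neg.cexp, ?_⟩
  fin_cases i <;> simp <;> ring

theorem mode_eq (ε : ℂ) (n : Fin 3 → ℤ) (p : Fin 3 → ℝ) : mode kx ky ε n p =
    cexp (-(I * ((kx * n 0 : ℝ) * p 0 + (ky * n 1 : ℝ) * p 1 + (Real.pi * n 2 : ℝ) * p 2))) +
    ε * cexp (-(I * ((kx * n 0 : ℝ) * p 0 + (ky * n 1 : ℝ) * p 1 +
      (-(Real.pi * n 2) : ℝ) * p 2))) := by
  simp only [mode, waveNumber, Matrix.cons_val]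
  push_cast
  ring_nf

/-- The reflected wave has the opposite vertical wave number, so `∂_z` flips the sign of `ε` and
exchanges sines with cosines. -/
theorem pderiv_mode_aux (ε : ℂ) (n : Fin 3 → ℤ) (i : Fin 3) (p : Fin 3 → ℝ) :
    pderiv i (mode kx ky ε n) p = -(I * waveNumber kx ky n i) *
      mode kx ky (if i = 2 then -ε else ε) n p := by
  obtain ⟨L, hL, hL'⟩ := hasFDerivAt_wave (kx * n 0) (ky * n 1) (Real.pi * n 2) p i
  obtain ⟨K, hK, hK'⟩ := hasFDerivAt_wave (kx * n 0) (ky * n 1) (-(Real.pi * n 2)) p i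
  have h := hL.add (hK.const_mul ε)
  rw [pderiv, show mode kx ky ε n = _ from funext (mode_eq ε n)]
  erw [h.fderiv]
  rw [mode_eq, add_apply, smul_apply, hL', hK']
  fin_cases i <;> simp [waveNumber] <;> ring

theorem pderiv_mode {i : Fin 3} (hi : i ≠ 2) (ε : ℂ) (n : Fin 3 → ℤ) (p : Fin 3 → ℝ) :
    pderiv i (mode kx ky ε n) p = -(I * waveNumber kx ky n i) * mode kx ky ε n p := by
  rw [pderiv_mode_aux, if_neg hi]

theorem pderiv_two_mode (ε : ℂ) (n : Fin 3 → ℤ) (p : Fin 3 → ℝ) :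
    pderiv 2 (mode kx ky ε n) p = -(I * waveNumber kx ky n 2) * mode kx ky (-ε) n p := by
  rw [pderiv_mode_aux, if_pos rfl]

theorem isPeriodicSmooth_mode (hkx : 0 < kx) (hky : 0 < ky) (ε : ℂ) (n : Fin 3 → ℤ) :
    IsPeriodicSmooth kx ky (mode kx ky ε n) := by
  have hx : (kx : ℂ) ≠ 0 := by exact_mod_cast hkx.ne'
  have hy : (ky : ℂ) ≠ 0 := by exact_mod_cast hky.ne'
  have per (a b : ℂ) (k : ℤ) (h : b = a + k * (2 * Real.pi * I)) : cexp b = cexp a := by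
    rw [h, Complex.exp_add, Complex.exp_int_mul_two_pi_mul_I, mul_one]
  refine ⟨?_, fun p => ?_, fun p => ?_⟩
  · have (i : Fin 3) : ContDiff ℝ ∞ fun p : Fin 3 → ℝ => (p i : ℂ) :=
      Complex.ofRealCLM.contDiff.comp (contDiff_apply ℝ ℝ i)
    unfold mode
    fun_prop
  · simp only [mode, waveNumber, Matrix.cons_val, Pi.add_apply, Pi.single_eq_same]
    congr 1
    · apply per _ _ (-n 0); simp; field_simp; ring
    · congr 1; apply per _ _ (-n 0); simp; field_simp; ring
  · simp only [mode, waveNumber, Matrix.cons_val, Pi.add_apply, Pi.single_eq_same]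
    congr 1
    · apply per _ _ (-n 1); simp; field_simp; ring
    · congr 1; apply per _ _ (-n 1); simp; field_simp; ring

/-- Factoring out a common phase of modulus one leaves a function of `z` alone, from which linear
vanishing at both walls can be read off. -/
theorem norm_mode_neg_one (n : Fin 3 → ℤ) (p : Fin 3 → ℝ) :
    ‖mode kx ky (-1) n p‖ = ‖cexp (I * (2 * Real.pi * n 2 * p 2 : ℝ)) - 1‖ := by
  have h : mode kx ky (-1) n p =
      -(cexp ((-(kx * n 0 * p 0 + ky * n 1 * p 1 + Real.pi * n 2 * p 2) : ℝ) * I) *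
        (cexp (I * (2 * Real.pi * n 2 * p 2 : ℝ)) - 1)) := by
    rw [mul_sub, ← Complex.exp_add, mode_eq, mul_one, neg_sub, neg_one_mul, ← sub_eq_add_neg]
    congr 2 <;> push_cast <;> ring
  rw [h, norm_neg, norm_mul, Complex.norm_exp_ofReal_mul_I, one_mul]

theorem norm_mode_neg_one_le (n : Fin 3 → ℤ) {p : Fin 3 → ℝ} (hp : p ∈ cell kx ky) :
    ‖mode kx ky (-1) n p‖ ≤ |2 * Real.pi * n 2| * p 2 ∧
      ‖mode kx ky (-1) n p‖ ≤ |2 * Real.pi * n 2| * (1 - p 2) := by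
  have h0 : 0 ≤ p 2 := hp.1 2
  have h1 : 0 ≤ 1 - p 2 := sub_nonneg.mpr (hp.2 2)
  rw [norm_mode_neg_one]
  constructor
  · refine (Real.norm_exp_I_mul_ofReal_sub_one_le).trans_eq ?_
    rw [Real.norm_eq_abs, abs_mul, abs_of_nonneg h0]
  -- As `n 2` is an integer, the exponential has period `1` in `z`, which transfers the estimate at
  -- `z = 0` to `z = 1`.
  · have : cexp (I * (2 * Real.pi * n 2 * p 2 : ℝ)) =
        cexp (I * (-(2 * Real.pi * n 2) * (1 - p 2) : ℝ)) := by
      rw [← mul_one (cexp (I * (-(2 * Real.pi * n 2) * (1 - p 2) : ℝ))),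
        ← Complex.exp_int_mul_two_pi_mul_I (n 2), ← Complex.exp_add]
      congr 1
      push_cast
      ring
    rw [this]
    refine (Real.norm_exp_I_mul_ofReal_sub_one_le).trans_eq ?_
    rw [Real.norm_eq_abs, abs_mul, abs_neg, abs_of_nonneg h1]

theorem integral_mul_neg_mul (f ψ : Field3) (c : ℂ) :
    ∫ p in cell kx ky, f p * (-c * ψ p) = -(c * ∫ p in cell kx ky, f p * ψ p) := by
  rw [← neg_mul, ← integral_const_mul]
  congr 1
  ext p
  ring

theorem IsWeakDeriv.coef_eq (hkx : 0 < kx) (hky : 0 < ky) {i : Fin 3} (hi : i ≠ 2) {f g : Field3}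
    (h : IsWeakDeriv kx ky i f g) (hf : MemL2 kx ky f) (hg : MemL2 kx ky g) (ε : ℂ)
    (n : Fin 3 → ℤ) : coef kx ky ε g n = I * waveNumber kx ky n i * coef kx ky ε f n := by
  have := h.integral_eq hf.integrableOn hg.integrableOn (isPeriodicSmooth_mode hkx hky ε n)
    (Or.inl hi)
  simp only [pderiv_mode hi, integral_mul_neg_mul, neg_inj] at this
  exact this.symm

/-- Sine modes vanish on the walls, so this holds with no boundary condition on `f`. The cosine
coefficients of `∂_z f` do need one; that is `WallCoef`. -/
theorem IsWeakDeriv.coef_two_eq (hkx : 0 < kx) (hky : 0 < ky) {f g : Field3}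
    (h : IsWeakDeriv kx ky 2 f g) (hf : MemL2 kx ky f) (hg : MemL2 kx ky g) (n : Fin 3 → ℤ) :
    coef kx ky (-1) g n = I * waveNumber kx ky n 2 * coef kx ky 1 f n := by
  have := h.integral_eq hf.integrableOn hg.integrableOn (isPeriodicSmooth_mode hkx hky (-1) n)
    (Or.inr ⟨_, fun p hp => norm_mode_neg_one_le n hp⟩)
  simp only [pderiv_two_mode, neg_neg, integral_mul_neg_mul, neg_inj] at this
  exact this.symm

/-! ### Calculus of coefficients and weak derivatives -/

theorem MemL2.add {f g : Field3} (hf : MemL2 kx ky f) (hg : MemL2 kx ky g) :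
    MemL2 kx ky (fun p => f p + g p) :=
  ⟨⟨fun p => by simp only [hf.1.1 p, hg.1.1 p], fun p => by simp only [hf.1.2 p, hg.1.2 p]⟩,
    hf.2.add hg.2⟩

theorem MemL2.sub {f g : Field3} (hf : MemL2 kx ky f) (hg : MemL2 kx ky g) :
    MemL2 kx ky (fun p => f p - g p) :=
  ⟨⟨fun p => by simp only [hf.1.1 p, hg.1.1 p], fun p => by simp only [hf.1.2 p, hg.1.2 p]⟩,
    hf.2.sub hg.2⟩

/-- The stratification factor `M(z) = ζ - z` times a field. -/
def stratified (ζ : ℝ) (f : Field3) : Field3 := fun p => ((ζ - p 2 : ℝ) : ℂ) * f p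

theorem MemL2.stratified {f : Field3} (hf : MemL2 kx ky f) (ζ : ℝ) :
    MemL2 kx ky (stratified ζ f) := by
  have hc : Continuous fun p : Fin 3 → ℝ => ((ζ - p 2 : ℝ) : ℂ) :=
    Complex.continuous_ofReal.comp (continuous_const.sub (continuous_apply 2))
  refine ⟨⟨fun p => ?_, fun p => ?_⟩, ?_⟩
  · simp [Penetrative.stratified, hf.1.1 p]
  · simp [Penetrative.stratified, hf.1.2 p]
  · refine MemLp.of_le_mul (c := |ζ| + 1) hf.2 (hc.aestronglyMeasurable.mul hf.2.1) ?_
    filter_upwards [ae_restrict_mem measurableSet_cell] with p hp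
    have h0 : 0 ≤ p 2 := hp.1 2
    have h1 : p 2 ≤ 1 := hp.2 2
    rw [Penetrative.stratified, norm_mul, Complex.norm_real, Real.norm_eq_abs]
    gcongr
    refine (abs_sub _ _).trans ?_
    rw [abs_of_nonneg h0]
    linarith

/-- `f` is integrable on the cell with coefficients `c`. -/
def HasCoef (kx ky : ℝ) (ε : ℂ) (f : Field3) (c : (Fin 3 → ℤ) → ℂ) : Prop :=
  IntegrableOn f (cell kx ky) ∧ ∀ n, coef kx ky ε f n = c n

namespace HasCoef

variable {ε : ℂ} {f g : Field3} {c d : (Fin 3 → ℤ) → ℂ}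

theorem of_memL2 (hf : MemL2 kx ky f) : HasCoef kx ky ε f (coef kx ky ε f) :=
  ⟨hf.integrableOn, fun _ => rfl⟩

theorem of_eq (hf : MemL2 kx ky f) (h : ∀ n, coef kx ky ε f n = c n) : HasCoef kx ky ε f c :=
  ⟨hf.integrableOn, h⟩

theorem add (hf : HasCoef kx ky ε f c) (hg : HasCoef kx ky ε g d) :
    HasCoef kx ky ε (fun p => f p + g p) (fun n => c n + d n) := by
  refine ⟨hf.1.add hg.1, fun n => ?_⟩
  beta_reduce
  rw [← hf.2 n, ← hg.2 n, coef, coef, coef, ← integral_add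
    (integrableOn_mul_continuous hf.1 (continuous_mode ε n))
    (integrableOn_mul_continuous hg.1 (continuous_mode ε n))]
  simp only [add_mul]

theorem const_mul (hf : HasCoef kx ky ε f c) (a : ℂ) :
    HasCoef kx ky ε (fun p => a * f p) (fun n => a * c n) := by
  refine ⟨hf.1.const_mul a, fun n => ?_⟩
  beta_reduce
  rw [← hf.2 n, coef, coef, ← integral_const_mul]
  simp only [mul_assoc]

theorem neg (hf : HasCoef kx ky ε f c) : HasCoef kx ky ε (fun p => -f p) (fun n => -c n) := by
  simpa using hf.const_mul (-1)

theorem sub (hf : HasCoef kx ky ε f c) (hg : HasCoef kx ky ε g d) :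
    HasCoef kx ky ε (fun p => f p - g p) (fun n => c n - d n) := by
  simpa [sub_eq_add_neg] using hf.add hg.neg

theorem eq_of_ae (hf : HasCoef kx ky ε f c) (hg : HasCoef kx ky ε g d)
    (h : ∀ᵐ p ∂(volume.restrict (cell kx ky)), f p = g p) (n : Fin 3 → ℤ) : c n = d n := by
  rw [← hf.2 n, ← hg.2 n]
  refine integral_congr_ae ?_
  filter_upwards [h] with p hp
  rw [hp]

end HasCoef

theorem hasCoef_zero {ε : ℂ} : HasCoef kx ky ε (fun _ => 0) (fun _ => 0) :=
  ⟨integrableOn_zero, fun n => by simp [coef]⟩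

theorem ae_eq_of_coef (hkx : 0 < kx) (hky : 0 < ky) {f g : Field3} (hf : MemL2 kx ky f)
    (hg : MemL2 kx ky g) (h : ∀ n, coef kx ky (-1) f n = coef kx ky (-1) g n) :
    ∀ᵐ p ∂(volume.restrict (cell kx ky)), f p = g p := by
  have h1 := ae_eq_zero_of_coef (ε := -1) hkx hky (by simp) (hf.sub hg) fun n => by
    rw [((HasCoef.of_memL2 hf).sub (HasCoef.of_memL2 hg)).2 n, sub_eq_zero]
    exact h n
  filter_upwards [h1] with p hp
  exact sub_eq_zero.mp hp

/-- The sine coefficients of a weak derivative are determined by `f`, and the sine system is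
complete. -/
theorem IsWeakDeriv.unique (hkx : 0 < kx) (hky : 0 < ky) {i : Fin 3} {f g g' : Field3}
    (hf : MemL2 kx ky f) (hg : MemL2 kx ky g) (hg' : MemL2 kx ky g')
    (h : IsWeakDeriv kx ky i f g) (h' : IsWeakDeriv kx ky i f g') :
    ∀ᵐ p ∂(volume.restrict (cell kx ky)), g p = g' p := by
  refine ae_eq_of_coef hkx hky hg hg' fun n => ?_
  by_cases hi : i = 2
  · subst hi
    rw [h.coef_two_eq hkx hky hf hg, h'.coef_two_eq hkx hky hf hg']
  · rw [h.coef_eq hkx hky hi hf hg, h'.coef_eq hkx hky hi hf hg']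

theorem IsTest.continuous {ψ : Field3} (h : IsTest kx ky ψ) : Continuous ψ := h.1.1.continuous

theorem IsWeakDeriv.add {i : Fin 3} {f g f' g' : Field3} (hf : MemL2 kx ky f)
    (hg : MemL2 kx ky g) (hf' : MemL2 kx ky f') (hg' : MemL2 kx ky g')
    (h : IsWeakDeriv kx ky i f f') (h' : IsWeakDeriv kx ky i g g') :
    IsWeakDeriv kx ky i (fun p => f p + g p) (fun p => f' p + g' p) := by
  intro ψ hψ
  have hd := continuous_pderiv hψ.1.1 i
  simp only [add_mul]
  rw [integral_add (integrableOn_mul_continuous hf.integrableOn hd)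
    (integrableOn_mul_continuous hg.integrableOn hd),
    integral_add (integrableOn_mul_continuous hf'.integrableOn hψ.continuous)
    (integrableOn_mul_continuous hg'.integrableOn hψ.continuous), h ψ hψ, h' ψ hψ, neg_add]

theorem IsWeakDeriv.congr {i : Fin 3} {f g f' : Field3} (h : IsWeakDeriv kx ky i f f')
    (hfg : ∀ᵐ p ∂(volume.restrict (cell kx ky)), f p = g p) : IsWeakDeriv kx ky i g f' := by
  intro ψ hψ
  rw [← h ψ hψ]
  refine integral_congr_ae ?_
  filter_upwards [hfg] with p hp
  rw [hp]

theorem IsTest.stratified {ψ : Field3} (hψ : IsTest kx ky ψ) (ζ : ℝ) :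
    IsTest kx ky (stratified ζ ψ) := by
  obtain ⟨⟨hs, hp⟩, δ, hδ, h0⟩ := hψ
  refine ⟨⟨?_, fun p => ?_, fun p => ?_⟩, δ, hδ, fun p hp => ?_⟩
  · refine ContDiff.mul ?_ hs
    exact Complex.ofRealCLM.contDiff.comp (contDiff_const.sub (contDiff_apply ℝ ℝ 2))
  · simp [Penetrative.stratified, hp.1 p]
  · simp [Penetrative.stratified, hp.2 p]
  · simp [Penetrative.stratified, h0 p hp]

/-- `M` depends on `z` only, so it can be moved onto the test function past a horizontal derivative.
-/
theorem IsWeakDeriv.stratified {i : Fin 3} (hi : i ≠ 2) {f g : Field3}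
    (h : IsWeakDeriv kx ky i f g) (ζ : ℝ) :
    IsWeakDeriv kx ky i (stratified ζ f) (stratified ζ g) := by
  intro ψ hψ
  have h1 := h _ (hψ.stratified ζ)
  have h2 : ∀ p, pderiv i (Penetrative.stratified ζ ψ) p = ((ζ - p 2 : ℝ) : ℂ) * pderiv i ψ p := by
    intro p
    have := pderiv_vertical_mul hψ.1.1 (p := p) ((hasDerivAt_id (p 2)).const_sub ζ) i
    rw [if_neg hi, zero_mul, zero_add] at this
    exact this
  simp only [h2] at h1
  simp only [Penetrative.stratified] at h1 ⊢
  convert h1 using 3 with p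
  · ring
  · ext p; ring

theorem WeakDifferentiable.wderiv_spec {i : Fin 3} {f : Field3}
    (h : WeakDifferentiable kx ky i f) :
    MemL2 kx ky (wderiv kx ky i f) ∧ IsWeakDeriv kx ky i f (wderiv kx ky i f) := by
  rw [wderiv, dif_pos h]
  exact h.choose_spec

theorem MemW.memL2 {m : ℕ} {f : Field3} (h : MemW kx ky m f) : MemL2 kx ky f := by
  cases m with
  | zero => exact h
  | succ m => exact h.1

theorem MemW.wderiv {m : ℕ} {f : Field3} (h : MemW kx ky (m + 1) f) (i : Fin 3) :
    MemW kx ky m (wderiv kx ky i f) := (h.2 i).2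

theorem MemW.isWeakDeriv {m : ℕ} {f : Field3} (h : MemW kx ky (m + 1) f) (i : Fin 3) :
    IsWeakDeriv kx ky i f (Penetrative.wderiv kx ky i f) := (h.2 i).1.wderiv_spec.2

/-- `wderiv` is a choice, so fields equal almost everywhere may receive different representatives;
uniqueness repairs this at each order. -/
theorem MemW.congr (hkx : 0 < kx) (hky : 0 < ky) {m : ℕ} {f g : Field3} (h : MemW kx ky m f)
    (hg : MemL2 kx ky g) (hfg : ∀ᵐ p ∂(volume.restrict (cell kx ky)), f p = g p) :
    MemW kx ky m g := by
  induction m generalizing f g with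
  | zero => exact hg
  | succ m ih =>
    refine ⟨hg, fun i => ?_⟩
    have hd := (h.isWeakDeriv i).congr hfg
    have hw : WeakDifferentiable kx ky i g := ⟨_, (h.wderiv i).memL2, hd⟩
    exact ⟨hw, ih (h.wderiv i) hw.wderiv_spec.1
      (IsWeakDeriv.unique hkx hky hg (h.wderiv i).memL2 hw.wderiv_spec.1 hd hw.wderiv_spec.2)⟩

theorem wderiv_add (hkx : 0 < kx) (hky : 0 < ky) {m : ℕ} {f g : Field3}
    (hf : MemW kx ky (m + 1) f) (hg : MemW kx ky (m + 1) g) (i : Fin 3) :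
    WeakDifferentiable kx ky i (fun p => f p + g p) ∧
    ∀ᵐ p ∂(volume.restrict (cell kx ky)), wderiv kx ky i f p + wderiv kx ky i g p =
      wderiv kx ky i (fun p => f p + g p) p := by
  have hL := (hf.wderiv i).memL2.add (hg.wderiv i).memL2
  have hd := (hf.isWeakDeriv i).add hf.memL2 hg.memL2 (hf.wderiv i).memL2 (hg.wderiv i).memL2
    (hg.isWeakDeriv i)
  have hw : WeakDifferentiable kx ky i (fun p => f p + g p) := ⟨_, hL, hd⟩
  exact ⟨hw, IsWeakDeriv.unique hkx hky (hf.memL2.add hg.memL2) hL hw.wderiv_spec.1 hd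
    hw.wderiv_spec.2⟩

theorem MemW.add (hkx : 0 < kx) (hky : 0 < ky) {m : ℕ} {f g : Field3} (hf : MemW kx ky m f)
    (hg : MemW kx ky m g) : MemW kx ky m (fun p => f p + g p) := by
  induction m generalizing f g with
  | zero => exact MemL2.add hf hg
  | succ m ih =>
    refine ⟨hf.memL2.add hg.memL2, fun i => ?_⟩
    obtain ⟨hw, hae⟩ := wderiv_add hkx hky hf hg i
    exact ⟨hw, (ih (hf.wderiv i) (hg.wderiv i)).congr hkx hky hw.wderiv_spec.1 hae⟩

/-! ### Wall conditions in terms of coefficients -/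

/-- The trace condition `f = 0` on the walls, in terms of coefficients. -/
def WallCoef (kx ky : ℝ) (f : Field3) : Prop :=
  ∀ n, coef kx ky 1 (wderiv kx ky 2 f) n = I * waveNumber kx ky n 2 * coef kx ky (-1) f n

theorem VanishesOnWalls.wallCoef (hkx : 0 < kx) (hky : 0 < ky) {f : Field3}
    (h : VanishesOnWalls kx ky f) : WallCoef kx ky f := by
  intro n
  have := h _ (isPeriodicSmooth_mode hkx hky 1 n)
  simp only [pderiv_two_mode, integral_mul_neg_mul, neg_inj] at this
  exact this.symm

theorem MemW.coef_wderiv (hkx : 0 < kx) (hky : 0 < ky) {m : ℕ} {f : Field3}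
    (h : MemW kx ky (m + 1) f) {i : Fin 3} (hi : i ≠ 2) (ε : ℂ) (n : Fin 3 → ℤ) :
    coef kx ky ε (Penetrative.wderiv kx ky i f) n =
      I * waveNumber kx ky n i * coef kx ky ε f n :=
  (h.isWeakDeriv i).coef_eq hkx hky hi h.memL2 (h.wderiv i).memL2 ε n

theorem MemW.coef_wderiv_two (hkx : 0 < kx) (hky : 0 < ky) {m : ℕ} {f : Field3}
    (h : MemW kx ky (m + 1) f) (n : Fin 3 → ℤ) :
    coef kx ky (-1) (Penetrative.wderiv kx ky 2 f) n =
      I * waveNumber kx ky n 2 * coef kx ky 1 f n :=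
  (h.isWeakDeriv 2).coef_two_eq hkx hky h.memL2 (h.wderiv 2).memL2 n

/-- Weak derivatives commute. -/
theorem wderiv_comm_two (hkx : 0 < kx) (hky : 0 < ky) {m : ℕ} {f : Field3}
    (h : MemW kx ky (m + 2) f) {i : Fin 3} (hi : i ≠ 2) :
    ∀ᵐ p ∂(volume.restrict (cell kx ky)),
      wderiv kx ky 2 (wderiv kx ky i f) p = wderiv kx ky i (wderiv kx ky 2 f) p := by
  refine ae_eq_of_coef hkx hky ((h.wderiv i).wderiv 2).memL2 ((h.wderiv 2).wderiv i).memL2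
    fun n => ?_
  rw [(h.wderiv i).coef_wderiv_two hkx hky, h.coef_wderiv hkx hky hi,
    (h.wderiv 2).coef_wderiv hkx hky hi, h.coef_wderiv_two hkx hky]
  ring

theorem coef_congr_ae {ε : ℂ} {f g : Field3}
    (h : ∀ᵐ p ∂(volume.restrict (cell kx ky)), f p = g p) (n : Fin 3 → ℤ) :
    coef kx ky ε f n = coef kx ky ε g n := by
  refine integral_congr_ae ?_
  filter_upwards [h] with p hp
  rw [hp]

/-- Horizontal derivatives are tangential to the walls, so a zero trace is inherited. -/
theorem WallCoef.wderiv (hkx : 0 < kx) (hky : 0 < ky) {m : ℕ} {f : Field3} (hw : WallCoef kx ky f)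
    (h : MemW kx ky (m + 2) f) {i : Fin 3} (hi : i ≠ 2) :
    WallCoef kx ky (wderiv kx ky i f) := by
  intro n
  rw [coef_congr_ae (wderiv_comm_two hkx hky h hi), (h.wderiv 2).coef_wderiv hkx hky hi, hw n,
    h.coef_wderiv hkx hky hi]
  ring

theorem WallCoef.add (hkx : 0 < kx) (hky : 0 < ky) {m : ℕ} {f g : Field3}
    (hf : MemW kx ky (m + 1) f) (hg : MemW kx ky (m + 1) g) (hwf : WallCoef kx ky f)
    (hwg : WallCoef kx ky g) : WallCoef kx ky (fun p => f p + g p) := by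
  intro n
  rw [← coef_congr_ae (wderiv_add hkx hky hf hg 2).2,
    ((HasCoef.of_memL2 (hf.wderiv 2).memL2).add (HasCoef.of_memL2 (hg.wderiv 2).memL2)).2,
    ((HasCoef.of_memL2 hf.memL2).add (HasCoef.of_memL2 hg.memL2)).2]
  beta_reduce
  rw [hwf n, hwg n, mul_add]

/-! ### Symbols of the differential operators -/

/-- The squared horizontal wave number. -/
def horizSq (kx ky : ℝ) (n : Fin 3 → ℤ) : ℝ := waveNumber kx ky n 0 ^ 2 + waveNumber kx ky n 1 ^ 2

/-- The squared wave number. -/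
def waveSq (kx ky : ℝ) (n : Fin 3 → ℤ) : ℝ := horizSq kx ky n + waveNumber kx ky n 2 ^ 2

theorem lap_eq (f : Field3) : lap kx ky f = fun p => wderiv kx ky 0 (wderiv kx ky 0 f) p +
    wderiv kx ky 1 (wderiv kx ky 1 f) p + wderiv kx ky 2 (wderiv kx ky 2 f) p := by
  ext p
  rw [lap, Fin.sum_univ_three]

theorem MemW.lap (hkx : 0 < kx) (hky : 0 < ky) {m : ℕ} {f : Field3} (h : MemW kx ky (m + 2) f) :
    MemW kx ky m (lap kx ky f) := by
  rw [lap_eq]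
  exact (((h.wderiv 0).wderiv 0).add hkx hky ((h.wderiv 1).wderiv 1)).add hkx hky
    ((h.wderiv 2).wderiv 2)

/-- Only the vertical second derivative depends on parity and wall conditions, so its symbol is left
as a hypothesis: it holds for sines if `f = 0` on the walls and for cosines if `∂_z f = 0` there. -/
theorem hasCoef_lap_aux (hkx : 0 < kx) (hky : 0 < ky) {m : ℕ} {f : Field3} {ε : ℂ}
    (h : MemW kx ky (m + 2) f)
    (h2 : ∀ n, coef kx ky ε (wderiv kx ky 2 (wderiv kx ky 2 f)) n =
      -(waveNumber kx ky n 2 : ℂ) ^ 2 * coef kx ky ε f n) :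
    HasCoef kx ky ε (lap kx ky f) (fun n => -(waveSq kx ky n : ℂ) * coef kx ky ε f n) := by
  refine HasCoef.of_eq (h.lap hkx hky).memL2 fun n => ?_
  rw [lap_eq, (((HasCoef.of_memL2 ((h.wderiv 0).wderiv 0).memL2).add
    (HasCoef.of_memL2 ((h.wderiv 1).wderiv 1).memL2)).add
    (HasCoef.of_memL2 ((h.wderiv 2).wderiv 2).memL2)).2 n]
  beta_reduce
  rw [h2 n, (h.wderiv 0).coef_wderiv hkx hky (by decide),
    (h.wderiv 1).coef_wderiv hkx hky (by decide),
    h.coef_wderiv hkx hky (by decide), h.coef_wderiv hkx hky (by decide), waveSq, horizSq]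
  push_cast
  linear_combination (waveNumber kx ky n 0 ^ 2 + waveNumber kx ky n 1 ^ 2 : ℂ) *
    coef kx ky ε f n * I_sq

theorem WallCoef.hasCoef_lap (hkx : 0 < kx) (hky : 0 < ky) {m : ℕ} {f : Field3}
    (hw : WallCoef kx ky f) (h : MemW kx ky (m + 2) f) :
    HasCoef kx ky (-1) (Penetrative.lap kx ky f)
      (fun n => -(waveSq kx ky n : ℂ) * coef kx ky (-1) f n) := by
  refine hasCoef_lap_aux hkx hky h fun n => ?_
  rw [(h.wderiv 2).coef_wderiv_two hkx hky, hw n]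
  linear_combination (waveNumber kx ky n 2 : ℂ) ^ 2 * coef kx ky (-1) f n * I_sq

theorem hasCoef_lap_of_wderiv (hkx : 0 < kx) (hky : 0 < ky) {m : ℕ} {f : Field3}
    (hw : WallCoef kx ky (wderiv kx ky 2 f)) (h : MemW kx ky (m + 2) f) :
    HasCoef kx ky 1 (lap kx ky f) (fun n => -(waveSq kx ky n : ℂ) * coef kx ky 1 f n) := by
  refine hasCoef_lap_aux hkx hky h fun n => ?_
  rw [hw n, h.coef_wderiv_two hkx hky]
  linear_combination (waveNumber kx ky n 2 : ℂ) ^ 2 * coef kx ky 1 f n * I_sq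

/-- This is where `∂_z² w = 0` enters: `Δw` vanishes on the walls as well, so `Δ` can be
diagonalised a second time in `opL`. -/
theorem WallCoef.lap (hkx : 0 < kx) (hky : 0 < ky) {m : ℕ} {f : Field3} (hw : WallCoef kx ky f)
    (hw2 : WallCoef kx ky (Penetrative.wderiv kx ky 2 (Penetrative.wderiv kx ky 2 f)))
    (h : MemW kx ky (m + 3) f) : WallCoef kx ky (lap kx ky f) := by
  rw [lap_eq]
  have h0 := (h.wderiv 0).wderiv 0
  have h1 := (h.wderiv 1).wderiv 1
  exact ((((hw.wderiv hkx hky h (by decide)).wderiv hkx hky (h.wderiv 0) (by decide)).add hkx hky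
    h0 h1 ((hw.wderiv hkx hky h (by decide)).wderiv hkx hky (h.wderiv 1) (by decide)))).add hkx hky
    (h0.add hkx hky h1) ((h.wderiv 2).wderiv 2) hw2

theorem hasCoef_opL (hkx : 0 < kx) (hky : 0 < ky) {m : ℕ} {f : Field3} (Da : ℝ)
    (hw : WallCoef kx ky f)
    (hw2 : WallCoef kx ky (wderiv kx ky 2 (wderiv kx ky 2 f))) (h : MemW kx ky (m + 4) f) :
    HasCoef kx ky (-1) (opL kx ky Da f)
      (fun n => -(((1 + Da * waveSq kx ky n) * waveSq kx ky n : ℝ) : ℂ) * coef kx ky (-1) f n) := by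
  have h1 := hw.hasCoef_lap hkx hky h
  have h2 := (hw.lap hkx hky hw2 h).hasCoef_lap hkx hky (h.lap hkx hky)
  have h3 := h1.sub (h2.const_mul Da)
  refine ⟨h3.1, fun n => (h3.2 n).trans ?_⟩
  beta_reduce
  rw [h1.2 n]
  push_cast
  ring

theorem coef_stratified_wderiv (hkx : 0 < kx) (hky : 0 < ky) {m : ℕ} {f : Field3}
    (h : MemW kx ky (m + 1) f) {i : Fin 3} (hi : i ≠ 2) (ζ : ℝ) (ε : ℂ) (n : Fin 3 → ℤ) :
    coef kx ky ε (stratified ζ (wderiv kx ky i f)) n =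
      I * waveNumber kx ky n i * coef kx ky ε (stratified ζ f) n :=
  ((h.isWeakDeriv i).stratified hi ζ).coef_eq hkx hky hi (h.memL2.stratified ζ)
    ((h.wderiv i).memL2.stratified ζ) ε n

/-- The coefficients of `M f` are not expressed through those of `f`; it is enough that `Δ₁` passes
through `M`. -/
theorem hasCoef_stratified_hlap (hkx : 0 < kx) (hky : 0 < ky) {m : ℕ} {f : Field3}
    (h : MemW kx ky (m + 2) f) (ζ : ℝ) (ε : ℂ) :
    HasCoef kx ky ε (stratified ζ (hlap kx ky f))
      (fun n => -(horizSq kx ky n : ℂ) * coef kx ky ε (stratified ζ f) n) := by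
  have h1 := (HasCoef.of_memL2 (ε := ε) (((h.wderiv 0).wderiv 0).memL2.stratified ζ)).add
    (HasCoef.of_memL2 (((h.wderiv 1).wderiv 1).memL2.stratified ζ))
  have h2 : stratified ζ (hlap kx ky f) = fun p =>
      stratified ζ (wderiv kx ky 0 (wderiv kx ky 0 f)) p +
      stratified ζ (wderiv kx ky 1 (wderiv kx ky 1 f)) p := by
    ext p
    simp only [stratified, hlap, mul_add]
  rw [h2]
  refine ⟨h1.1, fun n => (h1.2 n).trans ?_⟩
  beta_reduce
  rw [coef_stratified_wderiv hkx hky (h.wderiv 0) (by decide),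
    coef_stratified_wderiv hkx hky (h.wderiv 1) (by decide),
    coef_stratified_wderiv hkx hky h (by decide), coef_stratified_wderiv hkx hky h (by decide),
    horizSq]
  push_cast
  linear_combination (waveNumber kx ky n 0 ^ 2 + waveNumber kx ky n 1 ^ 2 : ℂ) *
    coef kx ky ε (stratified ζ f) n * I_sq

/-! ### The energy identity -/

/-- The form `∫ M(z) |∂ᵢθ|²` is real, in terms of coefficients. -/
theorem hasSum_im_stratified (hkx : 0 < kx) (hky : 0 < ky) {m : ℕ} {f : Field3}
    (h : MemW kx ky (m + 1) f) {i : Fin 3} (hi : i ≠ 2) (ζ : ℝ) :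
    HasSum (fun n => waveNumber kx ky n i ^ 2 *
      (coef kx ky (-1) (stratified ζ f) n * conj (coef kx ky (-1) f n)).im) 0 := by
  have h1 := hasSum_coef_parseval (ε := -1) hkx hky (by simp) ((h.wderiv i).memL2.stratified ζ)
    (h.wderiv i).memL2
  have h2 : ∀ p, stratified ζ (wderiv kx ky i f) p * conj (wderiv kx ky i f p) =
      (((ζ - p 2) * normSq (wderiv kx ky i f p) : ℝ) : ℂ) := by
    intro p
    rw [stratified, mul_assoc, Complex.mul_conj]
    push_cast
    ring
  simp only [h2, integral_complex_ofReal, ← Complex.ofReal_mul] at h1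
  have h3 := Complex.hasSum_im h1
  rw [Complex.ofReal_im] at h3
  refine h3.congr_fun fun n => ?_
  rw [coef_stratified_wderiv hkx hky h hi, h.coef_wderiv hkx hky hi, map_mul, map_mul, conj_I,
    conj_ofReal, ← Complex.im_ofReal_mul]
  congr 1
  push_cast
  linear_combination (waveNumber kx ky n i : ℂ) ^ 2 * coef kx ky (-1) (stratified ζ f) n *
    conj (coef kx ky (-1) f n) * I_sq

theorem mode_neg_one_eq_zero {n : Fin 3 → ℤ} (hn : n 2 = 0) : mode kx ky (-1) n = 0 := by
  ext p
  simp [mode, waveNumber, hn]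

/-- Covers the modes of zero weight in the energy identity: there `n 2 = 0`, and the sine mode
itself is zero. -/
theorem coef_neg_one_eq_zero_of_waveSq {n : Fin 3 → ℤ} (hn : waveSq kx ky n = 0) (f : Field3) :
    coef kx ky (-1) f n = 0 := by
  have h1 : waveNumber kx ky n 2 ^ 2 = 0 := by
    have := sq_nonneg (waveNumber kx ky n 0)
    have := sq_nonneg (waveNumber kx ky n 1)
    have := sq_nonneg (waveNumber kx ky n 2)
    rw [waveSq, horizSq] at hn
    linarith
  have h2 : n 2 = 0 := by
    simpa [waveNumber, Real.pi_ne_zero] using h1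
  simp [coef, mode_neg_one_eq_zero h2]

theorem waveSq_nonneg (n : Fin 3 → ℤ) : 0 ≤ waveSq kx ky n := by
  unfold waveSq horizSq
  positivity

/-- Multiplying the two heat equations by `(1 + Da k²) k²` times the conjugate temperatures. -/
theorem mode_identity {Ra H A γ k h K : ℝ} {σ a b w m : ℂ}
    (heat : σ * a + Ra * w = -(k : ℂ) * a + H * (b - a))
    (solid : A * (σ * b) = -(k : ℂ) * b - H * γ * (b - a))
    (vert : (K : ℂ) * w = -((h : ℂ) * (Ra * m))) :
    σ.im * (K * (γ * normSq a + A * normSq b)) = γ * Ra ^ 2 * (h * (m * conj a).im) := by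
  have e1 := congrArg re heat
  have e2 := congrArg im heat
  have e3 := congrArg re solid
  have e4 := congrArg im solid
  have e5 := congrArg re vert
  have e6 := congrArg im vert
  simp at e1 e2 e3 e4 e5 e6
  simp only [normSq_apply, mul_im, conj_re, conj_im]
  -- Imaginary part of `γ K conj a * heat + K conj b * solid - Ra γ conj a * vert`. The exchange
  -- terms drop out because `b conj a + a conj b` is real.
  linear_combination γ * K * (a.re * e2 - a.im * e1) + K * (b.re * e4 - b.im * e3) -
    Ra * γ * (a.re * e6 - a.im * e5)

/-- If the sine coefficients solve the mode equations, then `σ` is real or the mode is trivial. -/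
theorem im_eq_zero_or_trivial (hkx : 0 < kx) (hky : 0 < ky) {Ra Da ζ H A γ : ℝ} (hDa : 0 ≤ Da)
    (hA : 0 < A) (hγ : 0 < γ) {σ : ℂ} {m : ℕ} {w θ φ : Field3} (hθ : MemW kx ky (m + 1) θ)
    (hφ : MemL2 kx ky φ)
    (heat : ∀ n, σ * coef kx ky (-1) θ n + Ra * coef kx ky (-1) w n =
      -(waveSq kx ky n : ℂ) * coef kx ky (-1) θ n +
        H * (coef kx ky (-1) φ n - coef kx ky (-1) θ n))
    (solid : ∀ n, A * (σ * coef kx ky (-1) φ n) = -(waveSq kx ky n : ℂ) * coef kx ky (-1) φ n -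
      H * γ * (coef kx ky (-1) φ n - coef kx ky (-1) θ n))
    (vert : ∀ n, (((1 + Da * waveSq kx ky n) * waveSq kx ky n : ℝ) : ℂ) * coef kx ky (-1) w n =
      -((horizSq kx ky n : ℂ) * (Ra * coef kx ky (-1) (stratified ζ θ) n))) :
    σ.im = 0 ∨ ((∀ᵐ p ∂(volume.restrict (cell kx ky)), θ p = 0) ∧
      (∀ᵐ p ∂(volume.restrict (cell kx ky)), φ p = 0) ∧ ∀ n, coef kx ky (-1) w n = 0) := by
  refine or_iff_not_imp_left.mpr fun hσ => ?_
  have hK : ∀ n, 0 ≤ (1 + Da * waveSq kx ky n) * waveSq kx ky n := fun n => by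
    have := waveSq_nonneg (kx := kx) (ky := ky) n
    positivity
  have hK0 : ∀ n, (1 + Da * waveSq kx ky n) * waveSq kx ky n = 0 → waveSq kx ky n = 0 := by
    intro n hn
    have := waveSq_nonneg (kx := kx) (ky := ky) n
    refine (mul_eq_zero.mp hn).resolve_left (by positivity)
  have hsum : HasSum (fun n => σ.im * ((1 + Da * waveSq kx ky n) * waveSq kx ky n *
      (γ * normSq (coef kx ky (-1) θ n) + A * normSq (coef kx ky (-1) φ n)))) 0 := by
    have h1 := ((hasSum_im_stratified hkx hky hθ (i := 0) (by decide) ζ).add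
      (hasSum_im_stratified hkx hky hθ (i := 1) (by decide) ζ)).mul_left (γ * Ra ^ 2)
    rw [add_zero, mul_zero] at h1
    refine h1.congr_fun fun n => ?_
    rw [mode_identity (heat n) (solid n) (vert n), horizSq, add_mul]
  -- Dividing by `σ.im ≠ 0` leaves nonnegative terms with sum zero, so each one vanishes.
  have hsum' := hsum.mul_left σ.im⁻¹
  simp only [inv_mul_cancel_left₀ hσ, mul_zero] at hsum'
  have hz := (hasSum_zero_iff_of_nonneg fun n => mul_nonneg (hK n)
    (add_nonneg (mul_nonneg hγ.le (normSq_nonneg _)) (mul_nonneg hA.le (normSq_nonneg _)))).mp hsum'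
  have hcoef : ∀ n, coef kx ky (-1) θ n = 0 ∧ coef kx ky (-1) φ n = 0 := by
    intro n
    rcases mul_eq_zero.mp (congrFun hz n) with h | h
    · exact ⟨coef_neg_one_eq_zero_of_waveSq (hK0 n h) θ, coef_neg_one_eq_zero_of_waveSq (hK0 n h) φ⟩
    · have ha := mul_nonneg hγ.le (normSq_nonneg (coef kx ky (-1) θ n))
      have hb := mul_nonneg hA.le (normSq_nonneg (coef kx ky (-1) φ n))
      have ha' : γ * normSq (coef kx ky (-1) θ n) = 0 := by linarith
      have hb' : A * normSq (coef kx ky (-1) φ n) = 0 := by linarith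
      exact ⟨normSq_eq_zero.mp ((mul_eq_zero.mp ha').resolve_left hγ.ne'),
        normSq_eq_zero.mp ((mul_eq_zero.mp hb').resolve_left hA.ne')⟩
  have hθ0 := ae_eq_zero_of_coef (ε := -1) hkx hky (by simp) hθ.memL2 fun n => (hcoef n).1
  refine ⟨hθ0, ae_eq_zero_of_coef (ε := -1) hkx hky (by simp) hφ fun n => (hcoef n).2, fun n => ?_⟩
  -- Without temperature there is no buoyancy, and the vertical equation then forces the
  -- coefficients of `w` to vanish.
  have hm : coef kx ky (-1) (stratified ζ θ) n = 0 := by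
    rw [coef_congr_ae (g := fun _ => 0) (by filter_upwards [hθ0] with p hp; simp [stratified, hp])]
    exact hasCoef_zero.2 n
  have hv := vert n
  rw [hm, mul_zero, mul_zero, neg_zero] at hv
  rcases mul_eq_zero.mp hv with h | h
  · exact coef_neg_one_eq_zero_of_waveSq (hK0 n (by exact_mod_cast h)) w
  · exact h

/-! ### The reduced problem -/

theorem heat_coef {Ra H : ℝ} {σ : ℂ} {w θ φ Lθ : Field3} {k : (Fin 3 → ℤ) → ℂ}
    (hw : MemL2 kx ky w) (hθ : MemL2 kx ky θ) (hφ : MemL2 kx ky φ)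
    (hL : HasCoef kx ky (-1) Lθ (fun n => k n * coef kx ky (-1) θ n))
    (h : ∀ᵐ p ∂(volume.restrict (cell kx ky)), σ * θ p + Ra * w p = Lθ p + H * (φ p - θ p))
    (n : Fin 3 → ℤ) :
    σ * coef kx ky (-1) θ n + Ra * coef kx ky (-1) w n =
      k n * coef kx ky (-1) θ n + H * (coef kx ky (-1) φ n - coef kx ky (-1) θ n) :=
  (((HasCoef.of_memL2 hθ).const_mul σ).add ((HasCoef.of_memL2 hw).const_mul Ra)).eq_of_ae
    (hL.add (((HasCoef.of_memL2 hφ).sub (HasCoef.of_memL2 hθ)).const_mul H)) h n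

theorem solid_coef {H A γ : ℝ} {σ : ℂ} {θ φ Lφ : Field3} {k : (Fin 3 → ℤ) → ℂ}
    (hθ : MemL2 kx ky θ) (hφ : MemL2 kx ky φ)
    (hL : HasCoef kx ky (-1) Lφ (fun n => k n * coef kx ky (-1) φ n))
    (h : ∀ᵐ p ∂(volume.restrict (cell kx ky)),
      A * (σ * φ p) = Lφ p - H * γ * (φ p - θ p)) (n : Fin 3 → ℤ) :
    A * (σ * coef kx ky (-1) φ n) =
      k n * coef kx ky (-1) φ n - H * γ * (coef kx ky (-1) φ n - coef kx ky (-1) θ n) :=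
  (((HasCoef.of_memL2 hφ).const_mul σ).const_mul A).eq_of_ae
    (hL.sub (((HasCoef.of_memL2 hφ).sub (HasCoef.of_memL2 hθ)).const_mul (H * γ))) h n

theorem IsReducedMode.im_eq_zero {Ra Da ζ H A γ : ℝ} (hkx : 0 < kx) (hky : 0 < ky)
    (hDa : 0 ≤ Da) (hA : 0 < A) (hγ : 0 < γ) {σ : ℂ} {w θ φ : Field3}
    (h : IsReducedMode kx ky Ra Da ζ H A γ σ w θ φ) : σ.im = 0 := by
  have hγ' : (γ : ℂ) ≠ 0 := by exact_mod_cast hγ.ne'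
  have hsolid : ∀ᵐ p ∂(volume.restrict (cell kx ky)),
      A * (σ * φ p) = lap kx ky φ p - H * γ * (φ p - θ p) := by
    filter_upwards [h.solid_temp] with p hp
    field_simp at hp
    linear_combination hp
  have hvert : ∀ᵐ p ∂(volume.restrict (cell kx ky)),
      opL kx ky Da w p = -((Ra : ℂ) * stratified ζ (hlap kx ky θ) p) := by
    filter_upwards [h.vertical] with p hp
    rw [hp, stratified, mul_assoc]
  have vert := fun n => (hasCoef_opL hkx hky Da (h.bc_w.wallCoef hkx hky)
    (h.bc_wzz.wallCoef hkx hky) h.w_mem).eq_of_ae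
    ((hasCoef_stratified_hlap hkx hky h.theta_mem ζ (-1)).const_mul Ra).neg hvert n
  rcases im_eq_zero_or_trivial hkx hky hDa hA hγ h.theta_mem h.phi_mem.memL2
    (heat_coef h.w_mem.memL2 h.theta_mem.memL2 h.phi_mem.memL2
      ((h.bc_theta.wallCoef hkx hky).hasCoef_lap hkx hky h.theta_mem) h.fluid_temp)
    (solid_coef h.theta_mem.memL2 h.phi_mem.memL2
      ((h.bc_phi.wallCoef hkx hky).hasCoef_lap hkx hky h.phi_mem) hsolid)
    (fun n => by linear_combination -(vert n)) with him | ⟨hθ, hφ, hw⟩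
  · exact him
  · refine absurd ?_ h.nontrivial
    filter_upwards [hθ, hφ, ae_eq_zero_of_coef (ε := -1) hkx hky (by simp) h.w_mem.memL2 hw]
      with p h1 h2 h3
    exact ⟨h3, h1, h2⟩

/-! ### The full problem with pressure -/

/-- Elimination of the pressure in a single Fourier mode. -/
theorem pressure_elimination {Da Ra k0 k1 k2 : ℝ} {U V W P m : ℂ}
    (hU : U = -(I * k0 * P) + Da * (-((k0 ^ 2 + k1 ^ 2 + k2 ^ 2 : ℝ) : ℂ) * U))
    (hV : V = -(I * k1 * P) + Da * (-((k0 ^ 2 + k1 ^ 2 + k2 ^ 2 : ℝ) : ℂ) * V))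
    (hW : W = -(I * k2 * P) - Ra * m + Da * (-((k0 ^ 2 + k1 ^ 2 + k2 ^ 2 : ℝ) : ℂ) * W))
    (hdiv : I * k0 * U + I * k1 * V + I * k2 * W = 0) :
    (((1 + Da * (k0 ^ 2 + k1 ^ 2 + k2 ^ 2)) * (k0 ^ 2 + k1 ^ 2 + k2 ^ 2) : ℝ) : ℂ) * W =
      -(((k0 ^ 2 + k1 ^ 2 : ℝ) : ℂ) * (Ra * m)) := by
  push_cast at *
  -- The first three terms form the third component of the double curl on the Fourier side, in which
  -- `P` cancels; `hdiv` then replaces `k0 U + k1 V` by `-k2 W`.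
  linear_combination (k0 ^ 2 + k1 ^ 2 : ℂ) * hW - k0 * k2 * hU - k1 * k2 * hV -
    I * k2 * (1 + Da * (k0 ^ 2 + k1 ^ 2 + k2 ^ 2)) * hdiv +
    k2 * (1 + Da * (k0 ^ 2 + k1 ^ 2 + k2 ^ 2)) * (k0 * U + k1 * V + k2 * W) * I_sq

/-- In a mode without vertical velocity and buoyancy the fluid is at rest. -/
theorem horizontal_eq_zero {Da k0 k1 k2 : ℝ} (hDa : 0 ≤ Da) {U V P : ℂ}
    (hU : U = -(I * k0 * P) + Da * (-((k0 ^ 2 + k1 ^ 2 + k2 ^ 2 : ℝ) : ℂ) * U))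
    (hV : V = -(I * k1 * P) + Da * (-((k0 ^ 2 + k1 ^ 2 + k2 ^ 2 : ℝ) : ℂ) * V))
    (hdiv : I * k0 * U + I * k1 * V = 0) : U = 0 ∧ V = 0 := by
  have hK : ((1 + Da * (k0 ^ 2 + k1 ^ 2 + k2 ^ 2) : ℝ) : ℂ) ≠ 0 := by
    exact_mod_cast (by positivity : (1 + Da * (k0 ^ 2 + k1 ^ 2 + k2 ^ 2) : ℝ) ≠ 0)
  -- Horizontal divergence of the momentum equation. `P` itself may survive when `k0 = k1 = 0`, but
  -- only `k0 P` and `k1 P` enter.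
  have hP : ((k0 ^ 2 + k1 ^ 2 : ℝ) : ℂ) * P = 0 := by
    push_cast at *
    linear_combination -(I * k0) * hU - (I * k1) * hV +
      (1 + Da * (k0 ^ 2 + k1 ^ 2 + k2 ^ 2)) * hdiv + (k0 ^ 2 + k1 ^ 2 : ℂ) * P * I_sq
  have hkP : (k0 : ℂ) * P = 0 ∧ (k1 : ℂ) * P = 0 := by
    rcases mul_eq_zero.mp hP with h | h
    · have h' : k0 ^ 2 + k1 ^ 2 = 0 := by exact_mod_cast h
      have h0 : k0 = 0 := by nlinarith
      have h1 : k1 = 0 := by nlinarith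
      simp [h0, h1]
    · simp [h]
  constructor
  · refine (mul_eq_zero.mp ?_).resolve_left hK
    push_cast at *
    linear_combination hU - I * hkP.1
  · refine (mul_eq_zero.mp ?_).resolve_left hK
    push_cast at *
    linear_combination hV - I * hkP.2

/-- Each equation is tested with the parity of its unknowns: horizontal momentum and continuity with
cosines, vertical momentum and heat with sines. The pressure needs no wall condition, because `∂_z
π` is tested only with sines. -/
theorem IsNormalMode.im_eq_zero {Ra Da ζ H A γ : ℝ} (hkx : 0 < kx) (hky : 0 < ky)
    (hDa : 0 ≤ Da) (hA : 0 < A) (hγ : 0 < γ) {σ : ℂ} {u : Fin 3 → Field3} {π θ φ : Field3}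
    (h : IsNormalMode kx ky Ra Da ζ H A γ σ u π θ φ) : σ.im = 0 := by
  have hu := h.velocity_mem
  have hπ := h.pressure_mem
  have hU : ∀ n, coef kx ky 1 (u 0) n = -(I * waveNumber kx ky n 0 * coef kx ky 1 π n) +
      Da * (-(waveSq kx ky n : ℂ) * coef kx ky 1 (u 0) n) := fun n => by
    have := (HasCoef.of_memL2 (ε := 1) (hu 0).memL2).eq_of_ae
      ((HasCoef.of_memL2 (hπ.wderiv 0).memL2).neg.add
        ((hasCoef_lap_of_wderiv hkx hky (h.bc_u.wallCoef hkx hky) (hu 0)).const_mul Da))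
      (by filter_upwards [h.momentum 0] with p hp; simpa using hp) n
    rwa [hπ.coef_wderiv hkx hky (by decide)] at this
  have hV : ∀ n, coef kx ky 1 (u 1) n = -(I * waveNumber kx ky n 1 * coef kx ky 1 π n) +
      Da * (-(waveSq kx ky n : ℂ) * coef kx ky 1 (u 1) n) := fun n => by
    have := (HasCoef.of_memL2 (ε := 1) (hu 1).memL2).eq_of_ae
      ((HasCoef.of_memL2 (hπ.wderiv 1).memL2).neg.add
        ((hasCoef_lap_of_wderiv hkx hky (h.bc_v.wallCoef hkx hky) (hu 1)).const_mul Da))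
      (by filter_upwards [h.momentum 1] with p hp; simpa using hp) n
    rwa [hπ.coef_wderiv hkx hky (by decide)] at this
  have hW : ∀ n, coef kx ky (-1) (u 2) n = -(I * waveNumber kx ky n 2 * coef kx ky 1 π n) -
      Ra * coef kx ky (-1) (stratified ζ θ) n +
      Da * (-(waveSq kx ky n : ℂ) * coef kx ky (-1) (u 2) n) := fun n => by
    have := (HasCoef.of_memL2 (ε := -1) (hu 2).memL2).eq_of_ae
      (((HasCoef.of_memL2 (hπ.wderiv 2).memL2).neg.sub
        ((HasCoef.of_memL2 (h.theta_mem.memL2.stratified ζ)).const_mul Ra)).add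
        (((h.bc_w.wallCoef hkx hky).hasCoef_lap hkx hky (hu 2)).const_mul Da))
      (by filter_upwards [h.momentum 2] with p hp
          simpa [stratified, mul_assoc] using hp) n
    rwa [hπ.coef_wderiv_two hkx hky] at this
  -- The cosine coefficient of `∂_z w` appears here, so `w = 0` on the walls is used.
  have hdiv : ∀ n, I * waveNumber kx ky n 0 * coef kx ky 1 (u 0) n +
      I * waveNumber kx ky n 1 * coef kx ky 1 (u 1) n +
      I * waveNumber kx ky n 2 * coef kx ky (-1) (u 2) n = 0 := fun n => by
    have := (((HasCoef.of_memL2 (ε := 1) ((hu 0).wderiv 0).memL2).add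
      (HasCoef.of_memL2 ((hu 1).wderiv 1).memL2)).add
      (HasCoef.of_memL2 ((hu 2).wderiv 2).memL2)).eq_of_ae hasCoef_zero
      (by filter_upwards [h.div_free] with p hp; rwa [Fin.sum_univ_three] at hp) n
    rwa [(hu 0).coef_wderiv hkx hky (by decide), (hu 1).coef_wderiv hkx hky (by decide),
      h.bc_w.wallCoef hkx hky n] at this
  rcases im_eq_zero_or_trivial hkx hky hDa hA hγ h.theta_mem h.phi_mem.memL2
    (heat_coef (hu 2).memL2 h.theta_mem.memL2 h.phi_mem.memL2
      ((h.bc_theta.wallCoef hkx hky).hasCoef_lap hkx hky h.theta_mem) h.fluid_temp)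
    (solid_coef h.theta_mem.memL2 h.phi_mem.memL2
      ((h.bc_phi.wallCoef hkx hky).hasCoef_lap hkx hky h.phi_mem) h.solid_temp)
    (fun n => pressure_elimination (hU n) (hV n) (hW n) (hdiv n)) with him | ⟨hθ, hφ, hw⟩
  · exact him
  · refine absurd ?_ h.nontrivial
    have huv := fun n => horizontal_eq_zero hDa (hU n) (hV n) (by simpa [hw n] using hdiv n)
    filter_upwards [hθ, hφ,
      ae_eq_zero_of_coef (ε := 1) hkx hky (by simp) (hu 0).memL2 fun n => (huv n).1,
      ae_eq_zero_of_coef (ε := 1) hkx hky (by simp) (hu 1).memL2 fun n => (huv n).2,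
      ae_eq_zero_of_coef (ε := -1) hkx hky (by simp) (hu 2).memL2 hw] with p h1 h2 h3 h4 h5
    exact ⟨forall_fin_three.mpr ⟨h3, h4, h5⟩, h1, h2⟩

end Penetrative

end

theorem mainTheorem2 (kx ky Ra Da ζ H A γ : ℝ) (hkx : 0 < kx) (hky : 0 < ky)
    (hDa : 0 ≤ Da) (hA : 0 < A) (hγ : 0 < γ) :
    (∀ σ : ℂ, Penetrative.IsGrowthRate kx ky Ra Da ζ H A γ σ →
      σ.im = 0 ∧ (σ.re = 0 → σ = 0)) ∧
    (∀ σ : ℂ, Penetrative.IsReducedGrowthRate kx ky Ra Da ζ H A γ σ →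
      σ.im = 0 ∧ (σ.re = 0 → σ = 0)) := by
  refine ⟨fun σ ⟨u, π, θ, φ, h⟩ => ?_, fun σ ⟨w, θ, φ, h⟩ => ?_⟩
  · have him := h.im_eq_zero hkx hky hDa hA hγ
    exact ⟨him, fun hre => Complex.ext hre him⟩
  · have him := h.im_eq_zero hkx hky hDa hA hγ
    exact ⟨him, fun hre => Complex.ext hre him⟩
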